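/- All schemes are nonempty when called connected. Let $f\colon Y\to X$ be a morphism of schemes. \begin{itemize} \item $f$ is \emph{profinite-\'etale} (equivalently, $Y$ is a \emph{covering space} of $X$) if $Y=\underline{\operatorname{Spec}}\,\mathcal A$ over $X$, where $\mathcal A$ is a filtered colimit of quasi-coherent $\mathcal O_X$-algebras, each corresponding to a finite \'etale morphism to $X$; that is, $f$ is a cofiltered inverse limit of finite \'etale morphisms $Y_i\to X$. \item $f$ is \emph{Yoneda trivial} if there is a set $S$ of sections of $f$ such that for each connected scheme $Z$ the map $\operatorname{Maps}(Z,X)\times S\to\operatorname{Maps}(Z,Y)$, $(g,s)\mapsto s\circ g$, is a bijection. \item A connected scheme is \emph{simply connected} if all of its covering spaces are Yoneda trivial. A \emph{universal cover} of $X$ is a covering space $p\colon\tilde X\to X$ with $\tilde X$ connected and simply connected. \end{itemize} \textbf{Corollary.} Let $X$ be a connected, quasicompact and quasiseparated scheme. Then $X$ has a universal cover. Moreover, every universal cover $p\colon\tilde X\to X$ is a surjective profinite-\'etale morphism such that, for every profinite-\'etale morphism $f\colon Y\to X$, the projection $Y\times_X\tilde X\to\tilde X$ is Yoneda trivial. In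 particular, profinite-\'etale covering spaces of $X$ become Yoneda trivial after pullback to a profinite-\'etale cover. -/

import Mathlib

open CategoryTheory CategoryTheory.Limits AlgebraicGeometry

universe u

namespace CoveringSpace

/-- A morphism `f : Y ⟶ X` is profinite-étale if it is a cofiltered limit of finite étale morphisms
`t j : D j ⟶ X`. The transition maps between finite étale `X`-schemes are affine, so such a limit
is the relative spectrum over `X` of the corresponding filtered colimit of quasi-coherent
algebras. -/
def IsProfiniteEtale {Y X : Scheme.{u}} (f : Y ⟶ X) : Prop :=
  ∃ (J : Type u) (_ : SmallCategory J) (_ : IsCofiltered J) (D : J ⥤ Scheme.{u})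
    (t : D ⟶ (Functor.const J).obj X) (s : (Functor.const J).obj Y ⟶ D)
    (_ : IsLimit (Cone.mk Y s)),
    ∀ j, IsFinite (t.app j) ∧ Etale (t.app j) ∧ s.app j ≫ t.app j = f

/-- A morphism `f : Y ⟶ X` is Yoneda trivial if it has a set `S` of sections such that, for every
connected scheme `Z`, the map `Maps(Z, X) × S → Maps(Z, Y)`, `(g, s) ↦ s ∘ g`, is bijective. -/
def IsYonedaTrivial {Y X : Scheme.{u}} (f : Y ⟶ X) : Prop :=
  ∃ S : Set (X ⟶ Y), (∀ s ∈ S, s ≫ f = 𝟙 X) ∧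
    ∀ (Z : Scheme.{u}) [ConnectedSpace Z],
      Function.Bijective (fun p : (Z ⟶ X) × S ↦ p.1 ≫ (p.2 : X ⟶ Y))

/-- A scheme is simply connected if it is connected and all its profinite-étale covering spaces
are Yoneda trivial. -/
structure IsSimplyConnected (X : Scheme.{u}) : Prop where
  connected : ConnectedSpace X
  isYonedaTrivial : ∀ (Y : Scheme.{u}) (f : Y ⟶ X), IsProfiniteEtale f → IsYonedaTrivial f

/-- A universal cover of `X` is a profinite-étale covering space of `X` whose total space is
(connected and) simply connected. -/
structure IsUniversalCover {X' X : Scheme.{u}} (p : X' ⟶ X) : Prop where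
  isProfiniteEtale : IsProfiniteEtale p
  isSimplyConnected : IsSimplyConnected X'

end CoveringSpace

/-! The universal cover is the limit `X'` of all connected finite étale covers of `X` equipped with
a lift of a fixed geometric point. Base points make this system cofiltered: parallel pointed maps
from a connected cover coincide, and two covers are dominated by a component of their fibre product.

Simple connectedness reduces to one claim (`isSimplyConnected_of_exists_section`): every nonempty
finite étale `W ⟶ X'` has a section. Indeed, applying this to connected components gives sections
through every point, so a morphism from a connected scheme to a finite étale cover follows a
section, which is unique; compatible sections then pass to the limit.

For the claim, `W` is the base change of a finite étale `E'` over some member `i` of the system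
(`IsLimitCone.exists_isPullback_of_finite_etale`). The base point of `i` lifts to `E'`, and the
component of `E'` through the lift is again a member of the system. Its projection from `X'` lifts
`X' ⟶ i` to `E'`, which is a section of `W`.

The construction also needs that finite étale covers form a set up to isomorphism
(`exists_small_finite_etale`), that limits of schemes affine over a base exist
(`exists_isLimitCone`), and that the limit is connected (`connectedSpace_of_isLimitCone`).

For an arbitrary universal cover, surjectivity follows from nonemptiness of cofiltered limits of
fibres (`IsProfiniteEtale.surjective`), and Yoneda triviality of the pullbacks is simple
connectedness applied to the base change, which is profinite-étale again
(`IsProfiniteEtale.pullback_snd`). -/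

namespace CoveringSpace

attribute [simp] pullback.lift_fst pullback.lift_snd pullback.lift_fst_assoc
  pullback.lift_snd_assoc

/-! ### Limits described by families of legs, and their base change. -/

section LimitCone

variable {C : Type*} [Category* C] {J : Type*} [Category* J]

/-- The morphisms `π j : Y ⟶ D.obj j` exhibit `Y` as a limit of `D`. -/
structure IsLimitCone (D : J ⥤ C) (Y : C) (π : ∀ j, Y ⟶ D.obj j) : Prop where
  w : ∀ {i j : J} (f : i ⟶ j), π i ≫ D.map f = π j
  exists_lift : ∀ {Z : C} (s : ∀ j, Z ⟶ D.obj j), (∀ {i j : J} (f : i ⟶ j), s i ≫ D.map f = s j) →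
    ∃ l : Z ⟶ Y, ∀ j, l ≫ π j = s j
  hom_ext : ∀ {Z : C} (a b : Z ⟶ Y), (∀ j, a ≫ π j = b ≫ π j) → a = b

variable {D : J ⥤ C} {Y : C} {π : ∀ j, Y ⟶ D.obj j}

/-- The cone with given legs. -/
abbrev mkCone (D : J ⥤ C) (Y : C) (π : ∀ j, Y ⟶ D.obj j)
    (w : ∀ {i j : J} (f : i ⟶ j), π i ≫ D.map f = π j) : Cone D where
  pt := Y
  π :=
    { app := π
      naturality := fun i j f ↦ by
        change 𝟙 Y ≫ π j = π i ≫ D.map f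
        rw [w, Category.id_comp] }

/-- The limit cone of `IsLimitCone`. -/
noncomputable def IsLimitCone.isLimit (h : IsLimitCone D Y π) : IsLimit (mkCone D Y π h.w) where
  lift s := (h.exists_lift (fun j ↦ s.π.app j) (fun f ↦ s.w f)).choose
  fac s := (h.exists_lift (fun j ↦ s.π.app j) (fun f ↦ s.w f)).choose_spec
  uniq s _ hm := h.hom_ext _ _ fun j ↦ (hm j).trans
    ((h.exists_lift (fun j ↦ s.π.app j) (fun f ↦ s.w f)).choose_spec j).symm

lemma IsLimitCone.of_isLimit {c : Cone D} (hc : IsLimit c) :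
    IsLimitCone D c.pt (fun j ↦ c.π.app j) where
  w f := c.w f
  exists_lift s hs := ⟨hc.lift (mkCone D _ s hs), fun j ↦ hc.fac (mkCone D _ s hs) j⟩
  hom_ext _ _ h := hc.hom_ext h

/-- A natural transformation to a constant functor. -/
abbrev toConst {X : C} (t : ∀ j, D.obj j ⟶ X)
    (ht : ∀ {i j : J} (f : i ⟶ j), D.map f ≫ t j = t i) : D ⟶ (Functor.const J).obj X where
  app := t
  naturality i j f := by
    change D.map f ≫ t j = t i ≫ 𝟙 X
    rw [ht, Category.comp_id]

lemma IsLimitCone.eq_of_connected [IsConnected J] {X : C} {t : ∀ j, D.obj j ⟶ X}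
    (ht : ∀ {i j : J} (f : i ⟶ j), D.map f ≫ t j = t i) {Z : C} {s : ∀ j, Z ⟶ D.obj j}
    (hs : ∀ {i j : J} (f : i ⟶ j), s i ≫ D.map f = s j) (i j : J) : s i ≫ t i = s j ≫ t j :=
  constant_of_preserves_morphisms (fun j ↦ s j ≫ t j)
    (fun i j f ↦ by rw [← hs f, Category.assoc, ht]) i j

lemma IsLimitCone.comp_initial (h : IsLimitCone D Y π) {I : Type*} [Category* I] (F : I ⥤ J)
    [F.Initial] : IsLimitCone (F ⋙ D) Y (fun i ↦ π (F.obj i)) :=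
  .of_isLimit ((Functor.Initial.isLimitWhiskerEquiv F _).symm h.isLimit)

end LimitCone

section PullbackLimit

variable {C : Type*} [Category* C] [HasPullbacks C] {J : Type*} [Category* J]

/-- The base change along `g : T ⟶ X` of a diagram over `X`. -/
noncomputable abbrev pullbackDiagram (D : J ⥤ C) {X T : C} (t : ∀ j, D.obj j ⟶ X)
    (ht : ∀ {i j : J} (f : i ⟶ j), D.map f ≫ t j = t i) (g : T ⟶ X) : J ⥤ C where
  obj j := pullback (t j) g
  map {i j} f := pullback.lift (pullback.fst (t i) g ≫ D.map f) (pullback.snd (t i) g) (by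
    rw [Category.assoc, ht, pullback.condition])
  map_id j := by apply pullback.hom_ext <;> simp
  map_comp f g := by apply pullback.hom_ext <;> simp

variable {D : J ⥤ C} {X T : C} {t : ∀ j, D.obj j ⟶ X}
    (ht : ∀ {i j : J} (f : i ⟶ j), D.map f ≫ t j = t i) (g : T ⟶ X)

variable {P Y : C} {π : ∀ j, Y ⟶ D.obj j} {p : Y ⟶ X} {a : P ⟶ Y} {b : P ⟶ T}

/-- Base change commutes with connected limits. -/
lemma IsLimitCone.baseChange [IsConnected J] (hY : IsLimitCone D Y π) (hp : ∀ j, π j ≫ t j = p)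
    (h : IsPullback a b p g) :
    IsLimitCone (pullbackDiagram D t ht g) P
      (fun j ↦ pullback.lift (a ≫ π j) b (by rw [Category.assoc, hp, h.w])) where
  w f := by apply pullback.hom_ext <;> simp [hY.w]
  exists_lift {Z} s hs := by
    obtain ⟨l, hl⟩ := hY.exists_lift (fun j ↦ s j ≫ pullback.fst (t j) g) fun f ↦ by
      rw [← hs f]; simp
    let j₀ : J := Classical.arbitrary J
    -- The component in `T` is the same at every level because `J` is connected, so one level `j₀`
    -- suffices.
    have key (j : J) : s j₀ ≫ pullback.snd (t j₀) g = s j ≫ pullback.snd (t j) g :=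
      eq_of_connected (D := pullbackDiagram D t ht g) (t := fun j ↦ pullback.snd (t j) g)
        (fun f ↦ by simp) hs _ _
    refine ⟨h.lift l (s j₀ ≫ pullback.snd (t j₀) g) ?_, fun j ↦ ?_⟩
    · rw [← hp j₀, ← Category.assoc, hl, Category.assoc, pullback.condition, Category.assoc]
    · apply pullback.hom_ext
      · simp [hl]
      · simp [key j]
  hom_ext a b hab := by
    apply h.hom_ext
    · refine hY.hom_ext _ _ fun j ↦ ?_
      simpa using congr($(hab j) ≫ pullback.fst (t j) g)
    · simpa using congr($(hab (Classical.arbitrary J)) ≫ pullback.snd (t _) g)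

end PullbackLimit

end CoveringSpace

namespace CoveringSpace

/-! ### Rigidity and connected components of finite étale schemes. -/

section FiniteEtale

variable {X Y Z E : Scheme.{u}}

/-- By cancellation a section of an étale morphism is étale, and it is a monomorphism; an étale
monomorphism is an open immersion. -/
lemma isOpenImmersion_of_section {f : Y ⟶ X} [Etale f] {s : X ⟶ Y} (hs : s ≫ f = 𝟙 X) :
    IsOpenImmersion s := by
  have : Etale (s ≫ f) := by rw [hs]; infer_instance
  have : Etale s := Etale.of_comp s f
  have : Mono s := mono_of_mono_fac hs
  exact IsOpenImmersion.of_flat_of_mono s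

lemma isClosedImmersion_of_section {f : Y ⟶ X} [IsSeparated f] {s : X ⟶ Y} (hs : s ≫ f = 𝟙 X) :
    IsClosedImmersion s := by
  have : IsClosedImmersion (s ≫ f) := by rw [hs]; infer_instance
  exact IsClosedImmersion.of_comp s f

/-- Two lifts of a morphism from a connected scheme along a separated étale morphism agree
as soon as they agree after precomposition with a morphism from a nonempty scheme. -/
lemma eq_of_comp_eq_comp {T : Scheme.{u}} [Nonempty T] [ConnectedSpace Y] (h : Z ⟶ X) [Etale h]
    [IsSeparated h] {a b : Y ⟶ Z} (hab : a ≫ h = b ≫ h) (y : T ⟶ Y) (hy : y ≫ a = y ≫ b) :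
    a = b := by
  let l : Y ⟶ pullback h h := pullback.lift a b hab
  -- `e` is the equalizer of `a` and `b`: open since the diagonal of an étale morphism is an open
  -- immersion, closed since `h` is separated. The morphism `y` shows that it is nonempty, so it is
  -- all of `Y`.
  let e := pullback.fst l (pullback.diagonal h)
  have hne : (Set.range e).Nonempty := by
    let z : T ⟶ pullback l (pullback.diagonal h) := pullback.lift y (y ≫ a) (by
      apply pullback.hom_ext <;> simp [l, hy])
    exact ⟨e (z (Classical.arbitrary T)), Set.mem_range_self _⟩
  have hclopen : IsClopen (Set.range e) :=
    ⟨e.isClosedEmbedding.isClosed_range, e.isOpenEmbedding.isOpen_range⟩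
  have hsurj : Surjective e := ⟨Set.range_eq_univ.mp (hclopen.eq_univ hne)⟩
  have : Epi e := by
    have : IsIso e := isIso_of_isOpenImmersion_of_opensRange_eq_top e (by
      ext1; exact hclopen.eq_univ hne)
    infer_instance
  rw [← cancel_epi e]
  have hl : e ≫ l = pullback.snd _ _ ≫ pullback.diagonal h := pullback.condition
  have h1 : e ≫ a = e ≫ l ≫ pullback.fst _ _ := by simp [l]
  have h2 : e ≫ b = e ≫ l ≫ pullback.snd _ _ := by simp [l]
  rw [h1, h2, reassoc_of% hl, reassoc_of% hl]
  simp

/-- The image is closed by finiteness and open by étaleness. -/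
lemma surjective_of_finite_etale (f : E ⟶ X) [IsFinite f] [Etale f] [Nonempty E]
    [PreconnectedSpace X] : Surjective f :=
  ⟨Set.range_eq_univ.mp (IsClopen.eq_univ
    ⟨f.isClosedMap.isClosed_range, f.isOpenMap.isOpen_range⟩ (Set.range_nonempty f))⟩

lemma isFinite_ι_of_isClosed (U : E.Opens) (hU : IsClosed (U : Set E)) : IsClosedImmersion U.ι :=
  .of_isPreimmersion _ (by simpa using hU)

/-- Every point of a finite étale scheme over a connected scheme lies in a connected open and
closed subscheme. -/
lemma exists_connected_clopen (f : E ⟶ X) [IsFinite f] [Etale f] [ConnectedSpace X] (e : E) :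
    ∃ U : E.Opens, IsClosed (U : Set E) ∧ e ∈ U ∧ ConnectedSpace U := by
  classical
  let x₀ : X := Classical.arbitrary X
  have hfin : (f ⁻¹' {x₀}).Finite := f.finite_preimage_singleton x₀
  have hmeet (V : E.Opens) (hV : IsClosed (V : Set E)) (hne : (V : Set E).Nonempty) :
      (f ⁻¹' {x₀} ∩ V).Nonempty := by
    have := isFinite_ι_of_isClosed V hV
    have : Nonempty V := hne.to_subtype
    obtain ⟨v, hv⟩ := (surjective_of_finite_etale (V.ι ≫ f)).surj x₀
    exact ⟨v.1, hv, v.2⟩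
  -- Every nonempty clopen set meets the finite fibre over `x₀`, so a clopen neighbourhood of `e`
  -- with the fewest points in that fibre cannot be split.
  obtain ⟨U, ⟨hU, heU⟩, hmin⟩ := exists_minimalFor_of_wellFoundedLT
    (fun U : E.Opens ↦ IsClosed (U : Set E) ∧ e ∈ U) (fun U ↦ (f ⁻¹' {x₀} ∩ U).ncard)
    ⟨⊤, by simp⟩
  refine ⟨U, hU, heU, ?_⟩
  have : Nonempty U := ⟨⟨e, heU⟩⟩
  have : PreconnectedSpace U := by
    rw [preconnectedSpace_iff_clopen]
    intro s hs
    by_contra! H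
    wlog hes : (⟨e, heU⟩ : U) ∈ s generalizing s
    · exact this sᶜ hs.compl ⟨Set.nonempty_compl.mpr H.2, by simpa using H.1.ne_empty⟩ hes
    have hUe : Topology.IsClosedEmbedding (Subtype.val : U → E) := hU.isClosedEmbedding_subtypeVal
    have hUo : Topology.IsOpenEmbedding (Subtype.val : U → E) := U.2.isOpenEmbedding_subtypeVal
    let V : E.Opens := ⟨Subtype.val '' s, hUo.isOpenMap _ hs.isOpen⟩
    let V' : E.Opens := ⟨Subtype.val '' sᶜ, hUo.isOpenMap _ hs.compl.isOpen⟩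
    have hV : IsClosed (V : Set E) := hUe.isClosedMap _ hs.isClosed
    have hV' : IsClosed (V' : Set E) := hUe.isClosedMap _ hs.compl.isClosed
    have hVU : (V : Set E) ⊆ U := by rintro _ ⟨x, -, rfl⟩; exact x.2
    obtain ⟨y, hy, hyV'⟩ := hmeet V' hV' ((Set.nonempty_compl.mpr H.2).image _)
    have hlt : (f ⁻¹' {x₀} ∩ V).ncard < (f ⁻¹' {x₀} ∩ U).ncard := by
      refine Set.ncard_lt_ncard ⟨Set.inter_subset_inter_right _ hVU, fun hle ↦ ?_⟩
        (hfin.inter_of_left _)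
      obtain ⟨z, hz, rfl⟩ := hyV'
      obtain ⟨z', hz', h⟩ := (hle ⟨hy, z.2⟩).2
      exact hz (Subtype.ext h ▸ hz')
    exact hlt.not_ge (hmin ⟨hV, ⟨_, hes, rfl⟩⟩ hlt.le)
  exact ⟨inferInstance⟩

end FiniteEtale

/-! ### A criterion for simple connectedness by sections of finite étale covers. -/

section SimplyConnected

variable {X : Scheme.{u}}

/-- If nonempty finite étale schemes over a connected scheme have sections, then they have sections
through every point. -/
lemma exists_section_through [ConnectedSpace X]
    (H : ∀ (W : Scheme.{u}) (f : W ⟶ X) [IsFinite f] [Etale f] [Nonempty W],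
      ∃ s : X ⟶ W, s ≫ f = 𝟙 X)
    {W : Scheme.{u}} (f : W ⟶ X) [IsFinite f] [Etale f] (w : W) :
    ∃ s : X ⟶ W, s ≫ f = 𝟙 X ∧ w ∈ Set.range s := by
  obtain ⟨U, hU, hwU, hconn⟩ := exists_connected_clopen f w
  have := isFinite_ι_of_isClosed U hU
  obtain ⟨s, hs⟩ := H U (U.ι ≫ f)
  have := isOpenImmersion_of_section hs
  have := isClosedImmersion_of_section hs
  -- The image of a section is clopen, hence the whole connected component `U`, and in particular it
  -- contains `w`.
  have hr : Set.range s = Set.univ := IsClopen.eq_univ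
    ⟨s.isClosedEmbedding.isClosed_range, s.isOpenEmbedding.isOpen_range⟩ (Set.range_nonempty s)
  obtain ⟨x, hx⟩ := hr.ge (Set.mem_univ ⟨w, hwU⟩)
  refine ⟨s ≫ U.ι, by simpa using hs, x, ?_⟩
  simp [hx]

/-- Over such a scheme, morphisms from connected schemes to finite étale schemes factor through
sections. -/
lemma exists_eq_comp_section [ConnectedSpace X]
    (H : ∀ (W : Scheme.{u}) (f : W ⟶ X) [IsFinite f] [Etale f] [Nonempty W],
      ∃ s : X ⟶ W, s ≫ f = 𝟙 X)
    {W Z : Scheme.{u}} (f : W ⟶ X) [IsFinite f] [Etale f] [ConnectedSpace Z] (y : Z ⟶ W) :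
    ∃ s : X ⟶ W, s ≫ f = 𝟙 X ∧ y = (y ≫ f) ≫ s := by
  let z : Z := Classical.arbitrary Z
  obtain ⟨s, hs, hz⟩ := exists_section_through H f (y z)
  have := isOpenImmersion_of_section hs
  have := isClosedImmersion_of_section hs
  have hr : y ⁻¹' (Set.range s) = Set.univ := IsClopen.eq_univ
    (IsClopen.preimage ⟨s.isClosedEmbedding.isClosed_range, s.isOpenEmbedding.isOpen_range⟩
      y.continuous) ⟨z, hz⟩
  refine ⟨s, hs, ?_⟩
  let y' : Z ⟶ X := IsOpenImmersion.lift s y (by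
    rintro _ ⟨x, rfl⟩
    exact hr.ge (Set.mem_univ x))
  have hy' : y' ≫ s = y := IsOpenImmersion.lift_fac _ _ _
  rw [← hy', Category.assoc, Category.assoc, reassoc_of% hs]

/-- A reformulation of `IsProfiniteEtale` in terms of families of morphisms. -/
lemma isProfiniteEtale_iff {Y X : Scheme.{u}} (f : Y ⟶ X) :
    IsProfiniteEtale f ↔ ∃ (J : Type u) (_ : SmallCategory J) (_ : IsCofiltered J)
      (D : J ⥤ Scheme.{u}) (t : ∀ j, D.obj j ⟶ X) (π : ∀ j, Y ⟶ D.obj j),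
      IsLimitCone D Y π ∧ (∀ {i j : J} (φ : i ⟶ j), D.map φ ≫ t j = t i) ∧
      ∀ j, IsFinite (t j) ∧ Etale (t j) ∧ π j ≫ t j = f := by
  constructor
  · rintro ⟨J, _, _, D, t, s, hs, h⟩
    exact ⟨J, _, ‹_›, D, fun j ↦ t.app j, fun j ↦ s.app j, .of_isLimit hs,
      fun φ ↦ (t.naturality φ).trans (Category.comp_id _), h⟩
  · rintro ⟨J, _, _, D, t, π, hπ, ht, h⟩
    exact ⟨J, _, ‹_›, D, toConst t ht, (mkCone D Y π hπ.w).π, hπ.isLimit, h⟩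

/-- At each finite level a morphism from a connected `Z` follows a section, and this section is
determined by its restriction to `Z`. Uniqueness makes the sections of the levels compatible, so
they assemble to a section of the limit. -/
lemma isSimplyConnected_of_exists_section [ConnectedSpace X]
    (H : ∀ (W : Scheme.{u}) (f : W ⟶ X) [IsFinite f] [Etale f] [Nonempty W],
      ∃ s : X ⟶ W, s ≫ f = 𝟙 X) : IsSimplyConnected X := by
  refine ⟨inferInstance, fun Y f hf ↦ ?_⟩
  obtain ⟨J, _, _, D, t, π, hY, ht, h⟩ := (isProfiniteEtale_iff f).mp hf
  have hfin (j : J) := (h j).1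
  have het (j : J) := (h j).2.1
  have hsf (j : J) : π j ≫ t j = f := (h j).2.2
  -- All sections of `f` are taken as the set `S`.
  refine ⟨{σ | σ ≫ f = 𝟙 X}, fun _ h ↦ h, fun Z _ ↦ ⟨?_, ?_⟩⟩
  · rintro ⟨g, σ, hσ⟩ ⟨g', σ', hσ'⟩ hg
    change g ≫ σ = g' ≫ σ' at hg
    change σ ≫ f = 𝟙 X at hσ
    change σ' ≫ f = 𝟙 X at hσ'
    have hgg : g = g' := by
      simpa [hσ, hσ'] using congr($hg ≫ f)
    subst hgg
    congr
    refine hY.hom_ext _ _ fun j ↦ eq_of_comp_eq_comp (t j) ?_ g ?_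
    · rw [Category.assoc, Category.assoc, hsf, hσ, hσ']
    · rw [← Category.assoc, hg, Category.assoc]
  · intro y
    choose σ hσ hyσ using fun j ↦ exists_eq_comp_section H (t j) (y ≫ π j)
    simp only [Category.assoc, reassoc_of% hsf] at hyσ
    obtain ⟨l, hl⟩ := hY.exists_lift σ fun {i j} φ ↦ by
      refine eq_of_comp_eq_comp (t j) ?_ (y ≫ f) ?_
      · rw [Category.assoc, ht, hσ, hσ]
      · rw [Category.assoc, Category.assoc, ← hyσ j, ← reassoc_of% hyσ i, hY.w]
    have hlf : l ≫ f = 𝟙 X := by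
      let j : J := IsCofiltered.nonempty.some
      rw [← hsf j, reassoc_of% hl, hσ]
    refine ⟨⟨y ≫ f, l, hlf⟩, hY.hom_ext _ _ fun j ↦ ?_⟩
    change ((y ≫ f) ≫ l) ≫ π j = y ≫ π j
    rw [Category.assoc, hl, hyσ j, Category.assoc y]

end SimplyConnected

end CoveringSpace

namespace CoveringSpace

/-! ### Base change and surjectivity of profinite-étale morphisms, connectedness of limits. -/

variable {X Y T : Scheme.{u}}

lemma IsProfiniteEtale.pullback_snd {f : Y ⟶ X} (hf : IsProfiniteEtale f) (g : T ⟶ X) :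
    IsProfiniteEtale (pullback.snd f g) := by
  obtain ⟨J, _, _, D, t, π, hY, ht, h⟩ := (isProfiniteEtale_iff f).mp hf
  have : IsConnected J := IsCofiltered.isConnected J
  rw [isProfiniteEtale_iff]
  refine ⟨J, _, ‹_›, pullbackDiagram D t ht g, fun j ↦ pullback.snd (t j) g, _,
    hY.baseChange ht g (fun j ↦ (h j).2.2) (IsPullback.of_hasPullback f g), fun φ ↦ by simp,
    fun j ↦ ?_⟩
  have := (h j).1
  have := (h j).2.1
  exact ⟨inferInstance, inferInstance, by simp⟩

lemma isAffineHom_map {J : Type*} [Category* J] {D : J ⥤ Scheme.{u}} {t : ∀ j, D.obj j ⟶ X}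
    (ht : ∀ {i j : J} (φ : i ⟶ j), D.map φ ≫ t j = t i) (h : ∀ j, IsAffineHom (t j))
    {i j : J} (φ : i ⟶ j) : IsAffineHom (D.map φ) := by
  have := h i
  have := h j
  have : IsAffineHom (D.map φ ≫ t j) := by rw [ht]; infer_instance
  exact IsAffineHom.of_comp _ (t j)

/-- The fibre over a point is the cofiltered limit of the fibres of the finite levels. These are
nonempty and quasi-compact with affine transition maps, so their limit is nonempty. -/
lemma IsProfiniteEtale.surjective {f : Y ⟶ X} (hf : IsProfiniteEtale f) [Nonempty Y]
    [PreconnectedSpace X] : Surjective f := by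
  obtain ⟨J, _, _, D, t, π, hY, ht, h⟩ := (isProfiniteEtale_iff f).mp hf
  have : IsConnected J := IsCofiltered.isConnected J
  have hfin (j : J) := (h j).1
  have het (j : J) := (h j).2.1
  refine ⟨fun x ↦ ?_⟩
  let g := X.fromSpecResidueField x
  have hL := hY.baseChange ht g (fun j ↦ (h j).2.2) (IsPullback.of_hasPullback f g)
  have (j : J) : Nonempty ((pullbackDiagram D t ht g).obj j) := by
    have : Nonempty (D.obj j) := (inferInstance : Nonempty Y).map (π j)
    have := surjective_of_finite_etale (t j)
    have : Surjective (pullback.snd (t j) g) := inferInstance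
    exact (inferInstance : Nonempty (Spec (X.residueField x))).map
      fun y ↦ (this.surj y).choose
  have hsnd {i j : J} (φ : i ⟶ j) :
      (pullbackDiagram D t ht g).map φ ≫ pullback.snd (t j) g = pullback.snd (t i) g := by simp
  have {i j : J} (φ : i ⟶ j) : IsAffineHom ((pullbackDiagram D t ht g).map φ) :=
    isAffineHom_map hsnd (fun j ↦ inferInstance) φ
  have (j : J) : CompactSpace ((pullbackDiagram D t ht g).obj j) :=
    QuasiCompact.compactSpace_of_compactSpace (pullback.snd (t j) g)
  have hne : Nonempty (pullback f g : Scheme.{u}) :=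
    Scheme.nonempty_of_isLimit _ _ hL.isLimit
  obtain ⟨z⟩ := hne
  refine ⟨pullback.fst f g z, ?_⟩
  rw [← Scheme.Hom.comp_apply, pullback.condition, Scheme.Hom.comp_apply]
  exact Scheme.fromSpecResidueField_apply _ _

/-- Quasi-compact opens of the limit, and inclusions between them, come from a finite level. So a
clopen set and its complement are preimages of complementary opens of some `D n`, one of which is
empty. -/
lemma connectedSpace_of_isLimitCone {J : Type u} [SmallCategory J] [IsCofiltered J]
    {D : J ⥤ Scheme.{u}} {π : ∀ j, Y ⟶ D.obj j} (hY : IsLimitCone D Y π)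
    [∀ {i j : J} (φ : i ⟶ j), IsAffineHom (D.map φ)] [∀ j, ConnectedSpace (D.obj j)]
    [∀ j, CompactSpace (D.obj j)] [∀ j, QuasiSeparatedSpace (D.obj j)] : ConnectedSpace Y := by
  have : Nonempty Y := Scheme.nonempty_of_isLimit _ _ hY.isLimit
  have : CompactSpace Y := Scheme.compactSpace_of_isLimit _ _ hY.isLimit
  have : PreconnectedSpace Y := by
    rw [preconnectedSpace_iff_clopen]
    intro s hs
    obtain ⟨i, A, hA, hAs : π i ⁻¹ᵁ A = _⟩ :=
      exists_preimage_eq D _ hY.isLimit ⟨s, hs.isOpen⟩ hs.isClosed.isCompact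
    obtain ⟨j, B, hB, hBs : π j ⁻¹ᵁ B = _⟩ :=
      exists_preimage_eq D _ hY.isLimit ⟨sᶜ, hs.compl.isOpen⟩ hs.compl.isClosed.isCompact
    let k := IsCofiltered.min i j
    let A' : (D.obj k).Opens := D.map (IsCofiltered.minToLeft i j) ⁻¹ᵁ A
    let B' : (D.obj k).Opens := D.map (IsCofiltered.minToRight i j) ⁻¹ᵁ B
    have hA' : π k ⁻¹ᵁ A' = ⟨s, hs.isOpen⟩ := by
      rw [← Scheme.Hom.comp_preimage, hY.w, hAs]
    have hB' : π k ⁻¹ᵁ B' = ⟨sᶜ, hs.compl.isOpen⟩ := by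
      rw [← Scheme.Hom.comp_preimage, hY.w, hBs]
    have hcA' : IsCompact (A' : Set (D.obj k)) :=
      QuasiCompact.isCompact_preimage _ A.2 hA
    have hcB' : IsCompact (B' : Set (D.obj k)) :=
      QuasiCompact.isCompact_preimage _ B.2 hB
    obtain ⟨l, φ, hφ⟩ := exists_map_eq_top D _ hY.isLimit (A' ⊔ B') (by
      change π k ⁻¹ᵁ (A' ⊔ B') = ⊤
      rw [Scheme.Hom.preimage_sup, hA', hB']
      ext; simp)
    obtain ⟨m, ψ, hψ⟩ := exists_map_preimage_le_map_preimage D _ hY.isLimit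
      (i := k) (U := A' ⊓ B') (V := ⊥) (by
        exact hcA'.inter_of_isOpen hcB' A'.2 B'.2) (by
      change π k ⁻¹ᵁ (A' ⊓ B') ≤ π k ⁻¹ᵁ ⊥
      rw [Scheme.Hom.preimage_inf, hA', hB']
      rintro x ⟨h1, h2⟩
      exact h2 h1)
    obtain ⟨n, φ', ψ', hn⟩ := IsCofiltered.cospan φ ψ
    have hsup : D.map (φ' ≫ φ) ⁻¹ᵁ A' ⊔ D.map (φ' ≫ φ) ⁻¹ᵁ B' = ⊤ := by
      rw [← Scheme.Hom.preimage_sup, D.map_comp, Scheme.Hom.comp_preimage, hφ]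
      rfl
    have hinf : D.map (φ' ≫ φ) ⁻¹ᵁ A' ⊓ D.map (φ' ≫ φ) ⁻¹ᵁ B' = ⊥ := by
      rw [← Scheme.Hom.preimage_inf, hn, D.map_comp, Scheme.Hom.comp_preimage, ← le_bot_iff]
      exact Scheme.Hom.preimage_mono _ hψ
    have hcompl : ((D.map (φ' ≫ φ) ⁻¹ᵁ A' : (D.obj n).Opens) : Set (D.obj n))ᶜ =
        (D.map (φ' ≫ φ) ⁻¹ᵁ B' : (D.obj n).Opens) := by
      refine (IsCompl.compl_eq ⟨?_, ?_⟩)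
      · exact Set.disjoint_iff_inter_eq_empty.mpr congr(($hinf : Set (D.obj n)))
      · exact codisjoint_iff.mpr congr(($hsup : Set (D.obj n)))
    have hclopen : IsClopen ((D.map (φ' ≫ φ) ⁻¹ᵁ A' : (D.obj n).Opens) : Set (D.obj n)) :=
      ⟨⟨hcompl ▸ (D.map (φ' ≫ φ) ⁻¹ᵁ B').2⟩, (D.map (φ' ≫ φ) ⁻¹ᵁ A').2⟩
    have hs' : s = π n ⁻¹' (D.map (φ' ≫ φ) ⁻¹ᵁ A' : (D.obj n).Opens) := by
      have : π n ⁻¹ᵁ D.map (φ' ≫ φ) ⁻¹ᵁ A' = ⟨s, hs.isOpen⟩ := by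
        rw [← Scheme.Hom.comp_preimage, hY.w, hA']
      exact congr(($this : Set Y)).symm
    rcases isClopen_iff.mp hclopen with h | h
    · left; rw [hs', h, Set.preimage_empty]
    · right; rw [hs', h, Set.preimage_univ]
  exact ⟨inferInstance⟩

end CoveringSpace

namespace CoveringSpace

/-! ### Existence of limits of diagrams affine over a base. -/

section

variable {C : Type*} [Category* C] {J : Type*} [Category* J]

/-- If `D'` is the base change of the diagram `D` along `g`, then so is its limit. -/
lemma IsLimitCone.isPullback [IsConnected J] {D D' : J ⥤ C} {X T Y P : C} {t : ∀ j, D.obj j ⟶ X}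
    {t' : ∀ j, D'.obj j ⟶ T} {g : T ⟶ X} {φ : ∀ j, D'.obj j ⟶ D.obj j}
    (hφ : ∀ {i j : J} (f : i ⟶ j), φ i ≫ D.map f = D'.map f ≫ φ j)
    (ht' : ∀ {i j : J} (f : i ⟶ j), D'.map f ≫ t' j = t' i)
    (h : ∀ j, IsPullback (φ j) (t' j) (t j) g)
    {π : ∀ j, Y ⟶ D.obj j} {ρ : ∀ j, P ⟶ D'.obj j}
    (hY : IsLimitCone D Y π) (hP : IsLimitCone D' P ρ) {a : P ⟶ Y} {b : P ⟶ T} {p : Y ⟶ X}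
    (ha : ∀ j, a ≫ π j = ρ j ≫ φ j) (hb : ∀ j, ρ j ≫ t' j = b) (hp : ∀ j, π j ≫ t j = p) :
    IsPullback a b p g := by
  let j₀ : J := Classical.arbitrary J
  have w : a ≫ p = b ≫ g := by
    rw [← hp j₀, ← Category.assoc, ha, Category.assoc, (h j₀).w, ← Category.assoc, hb]
  have ex (s : PullbackCone p g) : ∃ l : s.pt ⟶ P, l ≫ a = s.fst ∧ l ≫ b = s.snd := by
    have hs (j : J) : (s.fst ≫ π j) ≫ t j = s.snd ≫ g := by
      rw [Category.assoc, hp, s.condition]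
    obtain ⟨l, hl⟩ := hP.exists_lift (fun j ↦ (h j).lift (s.fst ≫ π j) s.snd (hs j)) fun f ↦ by
      apply (h _).hom_ext
      · rw [Category.assoc, ← hφ, IsPullback.lift_fst_assoc, IsPullback.lift_fst, Category.assoc,
          hY.w]
      · rw [Category.assoc, ht', IsPullback.lift_snd, IsPullback.lift_snd]
    refine ⟨l, hY.hom_ext _ _ fun j ↦ ?_, ?_⟩
    · rw [Category.assoc, ha, reassoc_of% hl, IsPullback.lift_fst]
    · rw [← hb j₀, reassoc_of% hl, IsPullback.lift_snd]
  refine ⟨⟨w⟩, ⟨PullbackCone.IsLimit.mk w (fun s ↦ (ex s).choose)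
    (fun s ↦ (ex s).choose_spec.1) (fun s ↦ (ex s).choose_spec.2) fun s m h1 h2 ↦ ?_⟩⟩
  refine hP.hom_ext _ _ fun j ↦ (h j).hom_ext ?_ ?_
  · rw [Category.assoc, Category.assoc, ← ha, reassoc_of% h1,
      reassoc_of% (ex s).choose_spec.1]
  · rw [Category.assoc, Category.assoc, hb, h2, (ex s).choose_spec.2]

end

variable {J : Type u} [SmallCategory J]

/-- An affine diagram is isomorphic to `Spec` of its global sections, and `Spec` turns the colimit
of these rings into a limit. -/
lemma exists_isLimitCone_of_isAffine (D : J ⥤ Scheme.{u}) [∀ j, IsAffine (D.obj j)] :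
    ∃ (Y : Scheme.{u}) (π : ∀ j, Y ⟶ D.obj j), IsLimitCone D Y π := by
  have (j : J) : IsIso ((Functor.whiskerLeft D ΓSpec.adjunction.unit).app j) :=
    inferInstanceAs (IsIso (D.obj j).toSpecΓ)
  have : IsIso (Functor.whiskerLeft D ΓSpec.adjunction.unit) := NatIso.isIso_of_isIso_app _
  have : HasLimit (D ⋙ Scheme.Γ.rightOp) := inferInstance
  have : HasLimit ((D ⋙ Scheme.Γ.rightOp) ⋙ Scheme.Spec) :=
    ⟨_, isLimitOfPreserves Scheme.Spec (limit.isLimit (D ⋙ Scheme.Γ.rightOp))⟩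
  have : HasLimit D :=
    hasLimit_of_iso (F := (D ⋙ Scheme.Γ.rightOp) ⋙ Scheme.Spec)
      (asIso (Functor.whiskerLeft D ΓSpec.adjunction.unit)).symm
  exact ⟨limit D, fun j ↦ limit.π D j, .of_isLimit (limit.isLimit D)⟩

/-- Limits of connected diagrams of schemes affine over a base exist. -/
theorem exists_isLimitCone [IsConnected J] {X : Scheme.{u}} {D : J ⥤ Scheme.{u}}
    {t : ∀ j, D.obj j ⟶ X} (ht : ∀ {i j : J} (φ : i ⟶ j), D.map φ ≫ t j = t i)
    (h : ∀ j, IsAffineHom (t j)) :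
    ∃ (Y : Scheme.{u}) (π : ∀ j, Y ⟶ D.obj j), IsLimitCone D Y π := by
  -- The limit is taken among Zariski sheaves, where it exists, and is then shown to be
  -- representable by covering it with its restrictions to the affine opens of `X`, which are limits
  -- of affine schemes.
  let G : J ⥤ Sheaf Scheme.zariskiTopology.{u} (Type u) := D ⋙ Scheme.zariskiTopology.yoneda
  let F := limit G
  have hF : IsLimitCone (D ⋙ yoneda) F.1 (fun j ↦ (limit.π G j).hom) :=
    .of_isLimit (isLimitOfPreserves (sheafToPresheaf _ _) (limit.isLimit G))
  let ι := X.affineOpens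
  have hι (U : ι) (j : J) :
      IsAffine ((pullbackDiagram D t ht (Scheme.Opens.ι U.1)).obj j) := by
    have : IsAffine U.1 := U.2
    exact isAffine_of_isAffineHom (pullback.snd (t j) (Scheme.Opens.ι U.1))
  choose L ρ hL using fun U : ι ↦
    exists_isLimitCone_of_isAffine (pullbackDiagram D t ht (Scheme.Opens.ι U.1))
  have hyL (U : ι) : IsLimitCone (pullbackDiagram D t ht (Scheme.Opens.ι U.1) ⋙ yoneda)
      (yoneda.obj (L U)) (fun j ↦ yoneda.map (ρ U j)) :=
    .of_isLimit (isLimitOfPreserves yoneda (hL U).isLimit)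
  let j₀ : J := Classical.arbitrary J
  let p : F.1 ⟶ yoneda.obj X := (limit.π G j₀).hom ≫ yoneda.map (t j₀)
  have hp (j : J) : (limit.π G j).hom ≫ yoneda.map (t j) = p :=
    IsLimitCone.eq_of_connected (D := D ⋙ yoneda) (t := fun j ↦ yoneda.map (t j))
      (fun f ↦ by rw [Functor.comp_map, ← Functor.map_comp, ht]) hF.w _ _
  have ha (U : ι) := hF.exists_lift
    (fun j ↦ yoneda.map (ρ U j ≫ pullback.fst (t j) (Scheme.Opens.ι U.1))) fun f ↦ by
      rw [Functor.comp_map, ← Functor.map_comp, ← (hL U).w f, Category.assoc, Category.assoc]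
      simp
  choose f hf using ha
  have hpb (U : ι) : IsPullback (f U)
      (yoneda.map (ρ U j₀ ≫ pullback.snd (t j₀) (Scheme.Opens.ι U.1))) p
      (yoneda.map (Scheme.Opens.ι U.1)) := by
    refine IsLimitCone.isPullback (J := J) (D := D ⋙ yoneda)
      (D' := pullbackDiagram D t ht (Scheme.Opens.ι U.1) ⋙ yoneda)
      (φ := fun j ↦ yoneda.map (pullback.fst (t j) (Scheme.Opens.ι U.1)))
      (t' := fun j ↦ yoneda.map (pullback.snd (t j) (Scheme.Opens.ι U.1)))
      (t := fun j ↦ yoneda.map (t j)) ?_ ?_ (fun j ↦ (IsPullback.of_hasPullback _ _).map yoneda)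
      hF (hyL U) (fun j ↦ ?_) (fun j ↦ ?_) hp
    · intro i j f
      simp only [Functor.comp_map, ← Functor.map_comp]
      simp
    · intro i j f
      simp only [Functor.comp_map, ← Functor.map_comp]
      simp
    · rw [hf, Functor.map_comp]
    · rw [← Functor.map_comp]
      congr 1
      exact IsLimitCone.eq_of_connected (D := pullbackDiagram D t ht (Scheme.Opens.ι U.1))
        (t := fun j ↦ pullback.snd (t j) (Scheme.Opens.ι U.1)) (fun f ↦ by simp) (hL U).w _ _
  -- `f U` is the base change along `p` of the open immersion of `U` into `X`.
  have hopen (U : ι) : IsOpenImmersion.presheaf (f U) := by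
    have : IsOpenImmersion.presheaf.IsStableUnderBaseChange :=
      MorphismProperty.relative_isStableUnderBaseChange _
    refine MorphismProperty.of_isPullback (hpb U).flip ?_
    exact MorphismProperty.relative_map (P := @IsOpenImmersion) inferInstance
  -- A `Z`-valued point of `F` has an underlying morphism `g : Z ⟶ X`; over the preimage under `g`
  -- of an affine open `U` it lifts to `L U` by the cartesian square `hpb U`.
  have : Presheaf.IsLocallySurjective Scheme.zariskiTopology (Sigma.desc f) := by
    refine ⟨fun {Z} s ↦ ?_⟩
    let g : Z ⟶ X := yoneda.preimage (yonedaEquiv.symm s ≫ p)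
    have hg : yoneda.map g = yonedaEquiv.symm s ≫ p := yoneda.map_preimage _
    let 𝒰 : Z.OpenCover := Z.openCoverOfIsOpenCover (fun U : ι ↦ g ⁻¹ᵁ U.1) (by
      rw [TopologicalSpace.IsOpenCover, ← Scheme.Hom.preimage_iSup, iSup_affineOpens_eq_top]
      rfl)
    refine Scheme.zariskiTopology.superset_covering ?_ 𝒰.mem_grothendieckTopology
    rintro V v ⟨W, a, b, ⟨(U : ι)⟩, rfl⟩
    refine Sieve.downward_closed _ (?_ : Presheaf.imageSieve (Sigma.desc f) s (𝒰.f U)) a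
    let l := (hpb U).lift (yoneda.map (𝒰.f U) ≫ yonedaEquiv.symm s) (yoneda.map (g ∣_ U.1)) (by
      rw [Category.assoc, ← hg, ← Functor.map_comp]
      exact congrArg (fun x ↦ yoneda.map x) (morphismRestrict_ι g U.1).symm)
    refine ⟨(Sigma.ι (fun U ↦ yoneda.obj (L U)) U).app _ (yonedaEquiv l), ?_⟩
    have h1 : l ≫ f U = yoneda.map (𝒰.f U) ≫ yonedaEquiv.symm s := (hpb U).lift_fst _ _ _
    have h2 : yonedaEquiv (l ≫ f U) = F.1.map (𝒰.f U).op s := by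
      rw [h1]
      refine (yonedaEquiv_naturality (yonedaEquiv.symm s) (𝒰.f (↑U))).symm.trans ?_
      rw [Equiv.apply_symm_apply]
    rw [← h2, yonedaEquiv_comp]
    have h3 : Sigma.ι (fun U ↦ yoneda.obj (L U)) U ≫ Sigma.desc f = f U := by simp
    rw [← h3]
    rfl
  obtain ⟨Y, ⟨e⟩⟩ := Scheme.LocalRepresentability.isRepresentable hopen
  let i : yoneda.obj Y ≅ F.1 := Functor.representableByEquiv e
  refine ⟨Y, fun j ↦ yoneda.preimage (i.hom ≫ (limit.π G j).hom), ?_, ?_, ?_⟩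
  · intro j k f
    apply yoneda.map_injective
    rw [Functor.map_comp, Functor.map_preimage, Functor.map_preimage, Category.assoc]
    congr 1
    exact hF.w f
  · intro Z s hs
    obtain ⟨l, hl⟩ := hF.exists_lift (fun j ↦ yoneda.map (s j)) fun f ↦ by
      rw [Functor.comp_map, ← Functor.map_comp, hs]
    refine ⟨yoneda.preimage (l ≫ i.inv), fun j ↦ yoneda.map_injective ?_⟩
    rw [Functor.map_comp, Functor.map_preimage, Functor.map_preimage]
    simp [hl]
  · intro Z a b hab
    apply yoneda.map_injective
    rw [← cancel_mono i.hom]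
    refine hF.hom_ext _ _ fun j ↦ ?_
    simpa using congr(yoneda.map $(hab j))

end CoveringSpace

namespace CoveringSpace

instance : IsZariskiLocalAtSource @Etale.{u} :=
  HasRingHomProperty.instIsZariskiLocalAtSource (Q := RingHom.Etale)

/-! ### Finite étale schemes over `X` form a set up to isomorphism. -/

section Small

variable (X : Scheme.{u})

/-- A small category of affine étale `X`-schemes, as a subcategory of `X`-schemes. -/
noncomputable def affineEtaleToOver : SmallModel.{u} X.AffineEtale ⥤ Over X :=
  (equivSmallModel.{u} X.AffineEtale).inverse ⋙ Scheme.AffineEtale.Spec X ⋙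
    Scheme.Etale.forget X

instance : (affineEtaleToOver X).Full := by
  delta affineEtaleToOver
  infer_instance

variable {X}

lemma exists_affineEtaleToOver_iso {R : CommRingCat.{u}} (f : Spec R ⟶ X) [Etale f] :
    ∃ m, Nonempty ((affineEtaleToOver X).obj m ≅ Over.mk f) :=
  ⟨(equivSmallModel.{u} X.AffineEtale).functor.obj (Scheme.AffineEtale.mk f),
    ⟨(Scheme.AffineEtale.Spec X ⋙ Scheme.Etale.forget X).mapIso
      ((equivSmallModel.{u} X.AffineEtale).unitIso.symm.app (Scheme.AffineEtale.mk f))⟩⟩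

/-- Quasi-compact schemes have an affine étale cover. -/
lemma exists_affine_etale_cover (E : Scheme.{u}) [CompactSpace E] :
    ∃ (R : CommRingCat.{u}) (q : Spec R ⟶ E), Etale q ∧ Surjective q := by
  let 𝒰 := E.affineCover.finiteSubcover
  let q : (∐ 𝒰.X) ⟶ E := Sigma.desc 𝒰.f
  have : IsAffine (∐ 𝒰.X) := inferInstance
  have hq : Etale q := by
    rw [IsZariskiLocalAtSource.iff_of_openCover (P := @Etale.{u}) (sigmaOpenCover 𝒰.X)]
    intro (i : 𝒰.I₀)
    have hi : Sigma.ι 𝒰.X i ≫ q = 𝒰.f i := Sigma.ι_desc _ _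
    have : Etale (Sigma.ι 𝒰.X i ≫ q) := by
      rw [hi]
      infer_instance
    exact this
  have hq' : Surjective q := by
    refine ⟨fun x ↦ ?_⟩
    obtain ⟨i, y, rfl⟩ := 𝒰.exists_eq x
    refine ⟨Sigma.ι 𝒰.X i y, ?_⟩
    rw [← Scheme.Hom.comp_apply]
    simp [q]
  exact ⟨_, (Scheme.isoSpec _).inv ≫ q, inferInstance, inferInstance⟩

/-- The pair `f, g` of morphisms of affine étale `X`-schemes presents `h : E ⟶ X`. -/
def Presents {a b : SmallModel.{u} X.AffineEtale} (f g : b ⟶ a) {E : Scheme.{u}} (h : E ⟶ X) :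
    Prop :=
  ∃ q : (affineEtaleToOver X).obj a ⟶ Over.mk h, Epi q.left ∧
    (affineEtaleToOver X).map f ≫ q = (affineEtaleToOver X).map g ≫ q ∧
    ∀ (T : Over X) (k : (affineEtaleToOver X).obj a ⟶ T),
      (affineEtaleToOver X).map f ≫ k = (affineEtaleToOver X).map g ≫ k →
      ∃ u : Over.mk h ⟶ T, q ≫ u = k

/-- The scheme `E` is the coequalizer of the pair over `X`, uniqueness coming from the epimorphism,
so the pair determines it up to isomorphism. -/
lemma Presents.exists_iso {a b : SmallModel.{u} X.AffineEtale} {f g : b ⟶ a}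
    {E E' : Scheme.{u}} {h : E ⟶ X} {h' : E' ⟶ X} (H : Presents f g h) (H' : Presents f g h') :
    ∃ e : E ≅ E', e.hom ≫ h' = h := by
  obtain ⟨q, hq, hfg, hu⟩ := H
  obtain ⟨q', hq', hfg', hu'⟩ := H'
  have : Epi q := (Over.forget X).epi_of_epi_map hq
  have : Epi q' := (Over.forget X).epi_of_epi_map hq'
  obtain ⟨u, hu⟩ := hu _ q' hfg'
  obtain ⟨u', hu'⟩ := hu' _ q hfg
  let e : Over.mk h ≅ Over.mk h' :=
    ⟨u, u', by simp [← cancel_epi q, reassoc_of% hu, hu'],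
      by simp [← cancel_epi q', reassoc_of% hu', hu]⟩
  exact ⟨(Over.forget X).mapIso e, Over.w u⟩

/-- An affine étale cover `q` of `E` is an effective epimorphism, so `E` is its quotient by the
relation `pullback q q`; an affine étale cover `r` of this relation is an epimorphism and yields the
same quotient. Both covers are étale over `X`, so they have models in the small category. -/
lemma exists_presents {E : Scheme.{u}} (h : E ⟶ X) [Etale h] [CompactSpace E]
    [QuasiSeparatedSpace E] :
    ∃ (a b : SmallModel.{u} X.AffineEtale) (f g : b ⟶ a), Presents f g h := by
  obtain ⟨R, q, hq, hq'⟩ := exists_affine_etale_cover E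
  -- Quasi-separatedness of `E` enters here; it makes the relation quasi-compact, so that a single
  -- affine scheme covers it.
  have : QuasiCompact q := inferInstance
  have : CompactSpace (pullback q q : Scheme.{u}) :=
    QuasiCompact.compactSpace_of_compactSpace (pullback.fst q q)
  obtain ⟨R', r, hr, hr'⟩ := exists_affine_etale_cover (pullback q q)
  have : Epi r := Flat.epi_of_flat_of_surjective r
  have : Epi q := Flat.epi_of_flat_of_surjective q
  obtain ⟨a, ⟨ea⟩⟩ := exists_affineEtaleToOver_iso (q ≫ h)
  obtain ⟨b, ⟨eb⟩⟩ := exists_affineEtaleToOver_iso (r ≫ pullback.fst q q ≫ q ≫ h)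
  let F : Over.mk (r ≫ pullback.fst q q ≫ q ≫ h) ⟶ Over.mk (q ≫ h) :=
    Over.homMk (r ≫ pullback.fst q q)
  let G : Over.mk (r ≫ pullback.fst q q ≫ q ≫ h) ⟶ Over.mk (q ≫ h) :=
    Over.homMk (r ≫ pullback.snd q q) (by simp [pullback.condition_assoc])
  obtain ⟨f, hf⟩ := (affineEtaleToOver X).map_surjective (eb.hom ≫ F ≫ ea.inv)
  obtain ⟨g, hg⟩ := (affineEtaleToOver X).map_surjective (eb.hom ≫ G ≫ ea.inv)
  let Q : Over.mk (q ≫ h) ⟶ Over.mk h := Over.homMk q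
  refine ⟨a, b, f, g, ea.hom ≫ Q, ?_, ?_, ?_⟩
  · have : IsIso ea.hom.left := inferInstanceAs (IsIso ((Over.forget X).map ea.hom))
    exact inferInstanceAs (Epi (ea.hom.left ≫ q))
  · rw [hf, hg]
    simp only [Category.assoc, Iso.inv_hom_id_assoc]
    congr 1
    ext
    simp [F, G, Q, pullback.condition]
  · intro T k hk
    rw [hf, hg] at hk
    simp only [Category.assoc, cancel_epi] at hk
    have hk' := congr(($hk).left)
    change (r ≫ pullback.fst q q) ≫ (ea.inv ≫ k).left =
      (r ≫ pullback.snd q q) ≫ (ea.inv ≫ k).left at hk'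
    rw [Category.assoc, Category.assoc, cancel_epi] at hk'
    let u : E ⟶ T.left := EffectiveEpi.desc q (ea.inv ≫ k).left fun g₁ g₂ h12 ↦ by
      rw [← pullback.lift_fst g₁ g₂ h12, Category.assoc, hk', pullback.lift_snd_assoc]
    have hu : q ≫ u = (ea.inv ≫ k).left := EffectiveEpi.fac q _ _
    refine ⟨Over.homMk u ?_, ?_⟩
    · rw [← cancel_epi q, reassoc_of% hu]
      exact Over.w (ea.inv ≫ k)
    · rw [Category.assoc, ← cancel_epi ea.inv, Iso.inv_hom_id_assoc]
      ext
      exact hu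

/-- The isomorphism classes of finite étale schemes over `X` form a small set. -/
lemma exists_small_finite_etale (X : Scheme.{u}) [CompactSpace X] [QuasiSeparatedSpace X] :
    ∃ (ι : Type u) (E : ι → Scheme.{u}) (h : ∀ k, E k ⟶ X),
      (∀ k, IsFinite (h k) ∧ Etale (h k)) ∧
      ∀ (W : Scheme.{u}) (w : W ⟶ X) [IsFinite w] [Etale w],
        ∃ (k : ι) (e : W ≅ E k), e.hom ≫ h k = w := by
  let S := SmallModel.{u} X.AffineEtale
  -- The index set consists of the presentations, which are small data; one scheme is then chosen
  -- for each.
  let ι : Type u := {x : Σ a b : S, (b ⟶ a) × (b ⟶ a) //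
    ∃ (E : Scheme.{u}) (h : E ⟶ X), IsFinite h ∧ Etale h ∧ Presents x.2.2.1 x.2.2.2 h}
  choose E h hfin het hp using fun k : ι ↦ k.2
  refine ⟨ι, E, h, fun k ↦ ⟨hfin k, het k⟩, fun W w _ _ ↦ ?_⟩
  have : CompactSpace W := QuasiCompact.compactSpace_of_compactSpace w
  have : QuasiSeparatedSpace W := by
    exact quasiSeparatedSpace_of_quasiSeparated w
  obtain ⟨a, b, f, g, H⟩ := exists_presents w
  let k : ι := ⟨⟨a, b, f, g⟩, W, w, inferInstance, inferInstance, H⟩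
  exact ⟨k, H.exists_iso (hp k)⟩

end Small

end CoveringSpace

namespace CoveringSpace

/-! ### Descent of finite étale algebras to rings finitely presented over the integers. -/

section Ring

open TensorProduct

/-- If `B` is a flat `A₀`-algebra of finite type and `A ⊗ B` is finite over `A`, then
`A₁ ⊗ B` is finite over `A₁` for some subalgebra `A₁` of `A` of finite type over `A₀`. -/
lemma exists_subalgebra_fg_finite (A₀ A B : Type u) [CommRing A₀] [CommRing A] [CommRing B]
    [Algebra A₀ A] [Algebra A₀ B] [Module.Flat A₀ B] [Algebra.FiniteType A₀ B]
    [Module.Finite A (A ⊗[A₀] B)] :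
    ∃ A₁ : Subalgebra A₀ A, A₁.FG ∧ Module.Finite A₁ (A₁ ⊗[A₀] B) := by
  classical
  rcases subsingleton_or_nontrivial A with hA | hA
  · have : Subsingleton (⊥ : Subalgebra A₀ A) := inferInstance
    have := Module.subsingleton (⊥ : Subalgebra A₀ A) ((⊥ : Subalgebra A₀ A) ⊗[A₀] B)
    exact ⟨⊥, Subalgebra.fg_bot, inferInstance⟩
  obtain ⟨s, hs⟩ := ‹Algebra.FiniteType A₀ B›
  choose f hf hfs using fun b : B ↦
    Algebra.IsIntegral.isIntegral (R := A) (1 ⊗ₜ[A₀] b : A ⊗[A₀] B)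
  -- `A₁` is generated by the coefficients of monic equations for the finitely many algebra
  -- generators `1 ⊗ₜ b`.
  let A₁ : Subalgebra A₀ A := Algebra.adjoin A₀ (s.biUnion fun b ↦ (f b).coeffs)
  have hle (b : B) (hb : b ∈ s) : (f b) ∈ Polynomial.lifts (algebraMap A₁ A) := by
    rw [Polynomial.lifts_iff_coeff_lifts]
    intro n
    by_cases hn : (f b).coeff n = 0
    · rw [hn]; exact ⟨0, map_zero _⟩
    · refine ⟨⟨(f b).coeff n, Algebra.subset_adjoin ?_⟩, rfl⟩
      simp only [Finset.coe_biUnion, Set.mem_iUnion]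
      exact ⟨b, hb, Polynomial.coeff_mem_coeffs hn⟩
  -- Flatness of `B` embeds `A₁ ⊗ B` into `A ⊗ B`, so the integral equations already hold over `A₁`.
  have hinj : Function.Injective (Algebra.TensorProduct.map A₁.val (AlgHom.id A₀ B)) :=
    Module.Flat.rTensor_preserves_injective_linearMap (M := B) A₁.val.toLinearMap
      Subtype.val_injective
  have hint (b : B) (hb : b ∈ s) : IsIntegral A₁ (1 ⊗ₜ[A₀] b : A₁ ⊗[A₀] B) := by
    obtain ⟨g, hg, -, hgm⟩ := Polynomial.lifts_and_degree_eq_and_monic (hle b hb) (hf b)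
    have hcomp : ((Algebra.TensorProduct.map A₁.val (AlgHom.id A₀ B) : A₁ ⊗[A₀] B →+* A ⊗[A₀] B)).comp
        (algebraMap A₁ (A₁ ⊗[A₀] B)) = (algebraMap A (A ⊗[A₀] B)).comp (algebraMap A₁ A) := by
      ext x
      simp [Algebra.TensorProduct.algebraMap_apply]
    refine ⟨g, hgm, hinj ?_⟩
    rw [map_zero, ← hfs b, ← hg, Polynomial.eval₂_map, ← hcomp]
    refine (Polynomial.hom_eval₂ g (algebraMap A₁ (A₁ ⊗[A₀] B))
      (Algebra.TensorProduct.map A₁.val (AlgHom.id A₀ B) : A₁ ⊗[A₀] B →+* A ⊗[A₀] B) _).trans ?_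
    simp
  have hfin := fg_adjoin_of_finite (R := A₁)
    (s := (fun b ↦ (1 ⊗ₜ[A₀] b : A₁ ⊗[A₀] B)) '' s) (s.finite_toSet.image _) (by
      rintro _ ⟨b, hb, rfl⟩
      exact hint b hb)
  refine ⟨A₁, ⟨_, rfl⟩, ⟨?_⟩⟩
  have htop := Algebra.TensorProduct.adjoin_one_tmul_image_eq_top (A := A₁) (s : Set B) hs
  simpa [htop] using hfin

/-- Étaleness is already present over `A₀`; finiteness is gained by enlarging `A₀` to a subalgebra
`A₁` of finite type. Since `R` is noetherian, `A₁` is then finitely presented over `R`. -/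
lemma exists_finite_etale_descent_aux {R A₀ A B B₀ : Type u} [CommRing R] [IsNoetherianRing R]
    [CommRing A₀] [CommRing A] [CommRing B] [CommRing B₀] [Algebra A₀ A] [Algebra A B]
    [Algebra A₀ B₀] [Module.Finite A B] [Algebra.Etale A₀ B₀] (e : B ≃ₐ[A] A ⊗[A₀] B₀)
    (i : R →+* A₀) (hi : i.FiniteType) :
    ∃ (A₁ B₁ : CommRingCat.{u}) (φ : A₁ ⟶ .of A) (ψ : A₁ ⟶ B₁) (χ : B₁ ⟶ .of B),
      (∃ i : R →+* A₁, i.FinitePresentation) ∧ ψ.hom.Finite ∧ ψ.hom.Etale ∧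
      IsPushout φ ψ (CommRingCat.ofHom (algebraMap A B)) χ := by
  have : Module.Finite A (A ⊗[A₀] B₀) := Module.Finite.equiv e.toLinearEquiv
  have : Module.Flat A₀ B₀ := Algebra.Smooth.flat A₀ B₀
  obtain ⟨A₁, hA₁, hfin⟩ := exists_subalgebra_fg_finite A₀ A B₀
  refine ⟨.of A₁, .of (A₁ ⊗[A₀] B₀), CommRingCat.ofHom (algebraMap A₁ A),
    CommRingCat.ofHom (algebraMap A₁ (A₁ ⊗[A₀] B₀)),
    CommRingCat.ofHom (e.symm.toRingEquiv.toRingHom.comp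
      (Algebra.TensorProduct.map A₁.val (AlgHom.id A₀ B₀)).toRingHom), ?_, ?_, ?_, ?_⟩
  · have : Algebra.FiniteType A₀ A₁ := A₁.fg_iff_finiteType.mp hA₁
    exact ⟨(algebraMap A₀ A₁).comp i, RingHom.FinitePresentation.of_finiteType.mp
      (RingHom.FiniteType.comp (RingHom.finiteType_algebraMap.mpr this) hi)⟩
  · exact RingHom.finite_algebraMap.mpr hfin
  · exact RingHom.etale_algebraMap.mpr inferInstance
  · have h1 := CommRingCat.isPushout_tensorProduct A₀ A₁ B₀
    have h2 : IsPushout (CommRingCat.ofHom (algebraMap A₀ A)) (CommRingCat.ofHom (algebraMap A₀ B₀))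
        (CommRingCat.ofHom (algebraMap A B)) (CommRingCat.ofHom
          (e.symm.toRingEquiv.toRingHom.comp Algebra.TensorProduct.includeRight.toRingHom)) :=
      (CommRingCat.isPushout_tensorProduct A₀ A B₀).of_iso (Iso.refl _) (Iso.refl _)
        (Iso.refl _) e.symm.toRingEquiv.toCommRingCatIso (by simp) (by simp)
        (by ext x; exact e.symm.commutes x) rfl
    refine IsPushout.of_left ?_ ?_ h1
    · convert! h2
    · ext x
      change algebraMap A B x = e.symm (Algebra.TensorProduct.map A₁.val (AlgHom.id A₀ B₀) (x ⊗ₜ 1))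
      rw [← e.symm.commutes]
      simp [Algebra.TensorProduct.algebraMap_apply]

/-- Finite étale algebras descend to rings of finite type over `ℤ`. -/
lemma exists_finite_etale_descent (A B : Type u) [CommRing A] [CommRing B] [Algebra A B]
    [Module.Finite A B] [Algebra.Etale A B] :
    ∃ (A₁ B₁ : CommRingCat.{u}) (φ : A₁ ⟶ .of A) (ψ : A₁ ⟶ B₁) (χ : B₁ ⟶ .of B),
      (∃ i : ULift.{u} ℤ →+* A₁, i.FinitePresentation) ∧ ψ.hom.Finite ∧ ψ.hom.Etale ∧
      IsPushout φ ψ (CommRingCat.ofHom (algebraMap A B)) χ := by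
  algebraize [((algebraMap ℤ A).comp (ULift.ringEquiv : ULift.{u} ℤ ≃+* ℤ).toRingHom)]
  obtain ⟨A₀, B₀, _, _, hA₀, _, ⟨e⟩⟩ := Algebra.Etale.exists_subalgebra_fg (ULift.{u} ℤ) A B
  have : IsNoetherianRing (ULift.{u} ℤ) :=
    isNoetherianRing_of_ringEquiv ℤ ULift.ringEquiv.symm
  exact exists_finite_etale_descent_aux e (algebraMap (ULift.{u} ℤ) A₀)
    (RingHom.finiteType_algebraMap.mpr (A₀.fg_iff_finiteType.mp hA₀))

end Ring

/-- A finite étale scheme over an affine scheme is the base change of a finite étale scheme over an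
affine scheme of finite presentation over `ℤ`. -/
lemma exists_isPullback_of_isAffine {W Y : Scheme.{u}} [IsAffine Y] (w : W ⟶ Y) [IsFinite w]
    [Etale w] :
    ∃ (S T : Scheme.{u}) (f : T ⟶ S) (a : Y ⟶ S) (b : W ⟶ T),
      LocallyOfFinitePresentation (specULiftZIsTerminal.{u}.from S) ∧ IsFinite f ∧ Etale f ∧
      IsPullback b w f a := by
  have : IsAffine W := isAffine_of_isAffineHom w
  algebraize [w.appTop.hom]
  have : Module.Finite Γ(Y, ⊤) Γ(W, ⊤) := w.finite_appTop
  have : Algebra.Etale Γ(Y, ⊤) Γ(W, ⊤) :=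
    (HasRingHomProperty.iff_of_isAffine (P := @Etale.{u})).mp ‹Etale w›
  obtain ⟨A, B, φ, ψ, χ, ⟨i, hi⟩, hfin, het, H⟩ := exists_finite_etale_descent Γ(Y, ⊤) Γ(W, ⊤)
  refine ⟨Spec A, Spec B, Spec.map ψ, Y.isoSpec.hom ≫ Spec.map φ, W.isoSpec.hom ≫ Spec.map χ,
    ?_, ?_, ?_, ?_⟩
  · have h : LocallyOfFinitePresentation (Spec.map (CommRingCat.ofHom i)) :=
      (HasRingHomProperty.Spec_iff (P := @LocallyOfFinitePresentation)).mpr hi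
    convert! h
    exact specULiftZIsTerminal.hom_ext _ _
  · exact (IsFinite.SpecMap_iff _).mpr hfin
  · exact (HasRingHomProperty.Spec_iff (P := @Etale.{u})).mpr het
  · exact IsPullback.paste_horiz (.of_horiz_isIso ⟨(Scheme.isoSpec_hom_naturality w)⟩)
      (isPullback_SpecMap_of_isPushout _ _ _ _ H.flip)

end CoveringSpace

/-! ### Spreading out morphisms and isomorphisms from a limit to a finite level. -/

namespace CoveringSpace

instance isAffineHom_pullback_snd {X Y Z : Scheme.{u}} (f : X ⟶ Z) (g : Y ⟶ Z)
    [h : IsAffineHom f] : IsAffineHom (pullback.snd f g) :=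
  isAffineHom_isStableUnderBaseChange.of_isPullback (IsPullback.of_hasPullback f g) h

section

variable {J : Type u} [SmallCategory J] {D : J ⥤ Scheme.{u}} {Y : Scheme.{u}}
  {π : ∀ j, Y ⟶ D.obj j}

lemma IsLimitCone.exists_fac [IsCofiltered J] (hY : IsLimitCone D Y π)
    [∀ {i j : J} (φ : i ⟶ j), IsAffineHom (D.map φ)]
    [∀ j, CompactSpace (D.obj j)] [∀ j, QuasiSeparatedSpace (D.obj j)] {Z S : Scheme.{u}}
    (f : Z ⟶ S) [LocallyOfFinitePresentation f] {t : ∀ j, D.obj j ⟶ S}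
    (ht : ∀ {i j : J} (φ : i ⟶ j), D.map φ ≫ t j = t i) (a : Y ⟶ Z)
    (ha : ∀ j, π j ≫ t j = a ≫ f) : ∃ (i : J) (g : D.obj i ⟶ Z), π i ≫ g = a ∧ g ≫ f = t i :=
  Scheme.exists_π_app_comp_eq_of_locallyOfFinitePresentation D (toConst t ht) f _ hY.isLimit a (by
    ext j
    exact ha j)

lemma IsLimitCone.exists_map_comp_eq [IsCofiltered J] (hY : IsLimitCone D Y π)
    [∀ {i j : J} (φ : i ⟶ j), IsAffineHom (D.map φ)]
    [∀ j, CompactSpace (D.obj j)] {Z S : Scheme.{u}}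
    (f : Z ⟶ S) [LocallyOfFiniteType f] {t : ∀ j, D.obj j ⟶ S}
    (ht : ∀ {i j : J} (φ : i ⟶ j), D.map φ ≫ t j = t i) {i : J} (a b : D.obj i ⟶ Z)
    (ha : a ≫ f = t i) (hb : b ≫ f = t i) (hab : π i ≫ a = π i ≫ b) :
    ∃ (j : J) (φ : j ⟶ i), D.map φ ≫ a = D.map φ ≫ b :=
  Scheme.exists_hom_comp_eq_comp_of_locallyOfFiniteType D (toConst t ht) f _ hY.isLimit a b
    ha.symm hb.symm hab

variable (D) in
/-- The diagram `D` restricted to the objects over `i`. -/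
abbrev restrictOver (i : J) : Over i ⥤ Scheme.{u} where
  obj k := D.obj k.left
  map φ := D.map φ.left
  map_id k := D.map_id k.left
  map_comp φ ψ := D.map_comp φ.left ψ.left

variable (D) in
/-- The morphism of the diagram `D` to its value at `i`. -/
def toBase {i : J} (k : Over i) : D.obj k.left ⟶ D.obj i := D.map k.hom

instance isAffineHom_toBase [∀ {i j : J} (φ : i ⟶ j), IsAffineHom (D.map φ)] {i : J} (k : Over i) :
    IsAffineHom (toBase D k) :=
  inferInstanceAs (IsAffineHom (D.map k.hom))

@[simp]
lemma map_left_toBase {i : J} {k l : Over i} (φ : k ⟶ l) :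
    D.map φ.left ≫ toBase D l = toBase D k := by
  rw [toBase, ← D.map_comp, Over.w, toBase]

lemma IsLimitCone.w_toBase (hY : IsLimitCone D Y π) {i : J} (k : Over i) :
    π k.left ≫ toBase D k = π i :=
  hY.w k.hom

variable (D) in
/-- The base changes of `h : E ⟶ D.obj i` along the morphisms of the diagram `D`. -/
noncomputable abbrev overDiagram {i : J} {E : Scheme.{u}} (h : E ⟶ D.obj i) :
    Over i ⥤ Scheme.{u} where
  obj k := pullback (toBase D k) h
  map φ := pullback.lift (pullback.fst _ h ≫ D.map φ.left) (pullback.snd _ h) (by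
    rw [Category.assoc, map_left_toBase, pullback.condition])
  map_id k := by apply pullback.hom_ext <;> simp
  map_comp f g := by apply pullback.hom_ext <;> simp

section

variable {i : J} {E Q : Scheme.{u}} {h : E ⟶ D.obj i} {q : Q ⟶ E} {w : Q ⟶ Y}

/-- The projections from the base change of `h` to the limit of `D`. -/
noncomputable abbrev overπ (hY : IsLimitCone D Y π) (H : IsPullback q w h (π i)) (k : Over i) :
    Q ⟶ pullback (toBase D k) h :=
  pullback.lift (w ≫ π k.left) q (by rw [Category.assoc, hY.w_toBase, H.w])

/-- As `J` is cofiltered, passing to the objects over `i` is initial and does not change the limit;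
base change commutes with limits over the connected category `Over i`. -/
lemma IsLimitCone.isLimitCone_overDiagram [IsCofiltered J] (hY : IsLimitCone D Y π)
    (H : IsPullback q w h (π i)) :
    IsLimitCone (overDiagram D h) Q (overπ hY H) := by
  have : IsConnected (Over i) := IsCofiltered.isConnected _
  have h1 : IsLimitCone (restrictOver D i) Y (fun k ↦ π k.left) := hY.comp_initial (Over.forget i)
  exact h1.baseChange (J := Over i) (D := restrictOver D i) (t := fun k ↦ toBase D k)
    (fun φ ↦ by simp) h (fun k ↦ hY.w_toBase k) H.flip

lemma overπ_map (hY : IsLimitCone D Y π) (H : IsPullback q w h (π i)) {k l : Over i} (φ : k ⟶ l) :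
    overπ hY H k ≫ (overDiagram D h).map φ = overπ hY H l := by
  apply pullback.hom_ext <;> simp [hY.w]

section

variable {E' : Scheme.{u}} {h' : E' ⟶ D.obj i}

/-- The base change of a morphism between base changes of `h` and `h'`. -/
noncomputable def overHom {k l : Over i} (φ : l ⟶ k)
    (G : pullback (toBase D k) h ⟶ pullback (toBase D k) h')
    (hG : G ≫ pullback.fst _ _ = pullback.fst _ _) :
    pullback (toBase D l) h ⟶ pullback (toBase D l) h' :=
  pullback.lift (pullback.fst _ _) ((overDiagram D h).map φ ≫ G ≫ pullback.snd _ _) (by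
    rw [Category.assoc, Category.assoc, ← pullback.condition, reassoc_of% hG,
      pullback.lift_fst_assoc, Category.assoc, map_left_toBase])

lemma overHom_map {k l : Over i} (φ : l ⟶ k)
    (G : pullback (toBase D k) h ⟶ pullback (toBase D k) h')
    (hG : G ≫ pullback.fst _ _ = pullback.fst _ _) :
    overHom φ G hG ≫ (overDiagram D h').map φ = (overDiagram D h).map φ ≫ G := by
  apply pullback.hom_ext <;> simp [overHom, hG]

lemma overHom_fst {k l : Over i} (φ : l ⟶ k)
    (G : pullback (toBase D k) h ⟶ pullback (toBase D k) h')
    (hG : G ≫ pullback.fst _ _ = pullback.fst _ _) :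
    overHom φ G hG ≫ pullback.fst _ _ = pullback.fst _ _ :=
  pullback.lift_fst _ _ _

lemma overHom_comp_overHom {k l : Over i} (φ : l ⟶ k)
    (G : pullback (toBase D k) h ⟶ pullback (toBase D k) h')
    (hG : G ≫ pullback.fst _ _ = pullback.fst _ _)
    (G' : pullback (toBase D k) h' ⟶ pullback (toBase D k) h)
    (hG' : G' ≫ pullback.fst _ _ = pullback.fst _ _)
    (H : (overDiagram D h).map φ ≫ (G ≫ G' ≫ pullback.snd _ _) =
      (overDiagram D h).map φ ≫ pullback.snd _ _) :
    overHom φ G hG ≫ overHom φ G' hG' = 𝟙 _ := by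
  apply pullback.hom_ext
  · rw [Category.assoc, overHom_fst, overHom_fst, Category.id_comp]
  · have h1 : overHom φ G' hG' ≫ pullback.snd _ _ =
        (overDiagram D h').map φ ≫ G' ≫ pullback.snd _ _ := pullback.lift_snd _ _ _
    rw [Category.assoc, h1, reassoc_of% overHom_map φ G hG, H, pullback.lift_snd, Category.id_comp]

end

variable [∀ {i j : J} (φ : i ⟶ j), IsAffineHom (D.map φ)]

instance isAffineHom_overDiagram_map {k l : Over i} (φ : k ⟶ l) :
    IsAffineHom ((overDiagram D h).map φ) :=
  isAffineHom_map (D := overDiagram D h) (t := fun k ↦ pullback.snd (toBase D k) h)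
    (fun φ ↦ by simp) (fun k ↦ inferInstanceAs (IsAffineHom (pullback.snd (toBase D k) h))) φ

variable [CompactSpace E]

instance compactSpace_overDiagram (k : Over i) : CompactSpace ((overDiagram D h).obj k) :=
  QuasiCompact.compactSpace_of_compactSpace (pullback.snd (toBase D k) h)

instance quasiSeparatedSpace_overDiagram [QuasiSeparatedSpace E] (k : Over i) :
    QuasiSeparatedSpace ((overDiagram D h).obj k) :=
  quasiSeparatedSpace_of_quasiSeparated (pullback.snd (toBase D k) h)

variable {E' : Scheme.{u}} {h' : E' ⟶ D.obj i} [IsCofiltered J]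

/-- Morphisms out of the limit of the base changes of `h` come from a finite level. -/
lemma IsLimitCone.exists_fac_overDiagram (hY : IsLimitCone D Y π) (H : IsPullback q w h (π i))
    [QuasiSeparatedSpace E] [LocallyOfFinitePresentation h'] (r : Q ⟶ E')
    (hr : r ≫ h' = w ≫ π i) :
    ∃ (k : Over i) (g : pullback (toBase D k) h ⟶ E'), g ≫ h' = pullback.snd _ _ ≫ h ∧
      overπ hY H k ≫ g = r := by
  obtain ⟨k, g, hg, hg'⟩ := (hY.isLimitCone_overDiagram H).exists_fac h'
    (t := fun k ↦ pullback.snd (toBase D k) h ≫ h) (fun φ ↦ by simp) r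
    (fun k ↦ by rw [pullback.lift_snd_assoc, hr, H.w])
  exact ⟨k, g, hg', hg⟩

/-- Morphisms that agree on the limit of the base changes of `h` agree at a finite level. -/
lemma IsLimitCone.exists_comp_eq_overDiagram (hY : IsLimitCone D Y π) (H : IsPullback q w h (π i))
    [LocallyOfFiniteType h'] {k : Over i} (a b : pullback (toBase D k) h ⟶ E')
    (ha : a ≫ h' = pullback.snd _ _ ≫ h) (hb : b ≫ h' = pullback.snd _ _ ≫ h)
    (hab : overπ hY H k ≫ a = overπ hY H k ≫ b) :
    ∃ (l : Over i) (φ : l ⟶ k), (overDiagram D h).map φ ≫ a = (overDiagram D h).map φ ≫ b :=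
  (hY.isLimitCone_overDiagram H).exists_map_comp_eq h'
    (t := fun k ↦ pullback.snd (toBase D k) h ≫ h) (fun φ ↦ by simp) a b ha hb hab

/-- Schemes of finite presentation over `D.obj i` whose base changes to the limit of `D` are
isomorphic become isomorphic at a finite level. -/
lemma IsLimitCone.exists_iso_overDiagram (hY : IsLimitCone D Y π) [CompactSpace E']
    [QuasiSeparatedSpace E] [QuasiSeparatedSpace E']
    [LocallyOfFinitePresentation h] [LocallyOfFinitePresentation h'] {q' : Q ⟶ E'}
    (H : IsPullback q w h (π i)) (H' : IsPullback q' w h' (π i)) :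
    ∃ (k : Over i) (e : pullback (toBase D k) h ≅ pullback (toBase D k) h'),
      e.hom ≫ pullback.fst _ _ = pullback.fst _ _ ∧ overπ hY H k ≫ e.hom = overπ hY H' k := by
  obtain ⟨k₁, g, hg, hgρ⟩ := hY.exists_fac_overDiagram H (h' := h') q' H'.w
  obtain ⟨k₂, g', hg', hgρ'⟩ := hY.exists_fac_overDiagram H' (h' := h) q H.w
  let m := IsCofiltered.min k₁ k₂
  let G : pullback (toBase D m) h ⟶ pullback (toBase D m) h' :=
    pullback.lift (pullback.fst _ _)
      ((overDiagram D h).map (IsCofiltered.minToLeft k₁ k₂) ≫ g) (by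
        rw [Category.assoc, hg, pullback.lift_snd_assoc, pullback.condition])
  let G' : pullback (toBase D m) h' ⟶ pullback (toBase D m) h :=
    pullback.lift (pullback.fst _ _)
      ((overDiagram D h').map (IsCofiltered.minToRight k₁ k₂) ≫ g') (by
        rw [Category.assoc, hg', pullback.lift_snd_assoc, pullback.condition])
  have hGf : G ≫ pullback.fst _ _ = pullback.fst _ _ := pullback.lift_fst _ _ _
  have hGf' : G' ≫ pullback.fst _ _ = pullback.fst _ _ := pullback.lift_fst _ _ _
  have hG : overπ hY H m ≫ G = overπ hY H' m := by
    apply pullback.hom_ext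
    · rw [Category.assoc, hGf, pullback.lift_fst, pullback.lift_fst]
    · rw [Category.assoc, pullback.lift_snd, reassoc_of% overπ_map hY H, hgρ, pullback.lift_snd]
  have hG' : overπ hY H' m ≫ G' = overπ hY H m := by
    apply pullback.hom_ext
    · rw [Category.assoc, hGf', pullback.lift_fst, pullback.lift_fst]
    · rw [Category.assoc, pullback.lift_snd, reassoc_of% overπ_map hY H', hgρ', pullback.lift_snd]
  -- `G` and `G'` are inverse to each other only in the limit; their composites become identities
  -- after raising the level, once for each composite.
  obtain ⟨l₁, φ₁, hφ₁⟩ := hY.exists_comp_eq_overDiagram H (k := m) (h' := h)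
    (G ≫ G' ≫ pullback.snd _ _) (pullback.snd _ _)
    (by rw [Category.assoc, Category.assoc, ← pullback.condition, reassoc_of% hGf',
      reassoc_of% hGf]) rfl (by rw [reassoc_of% hG, reassoc_of% hG'])
  obtain ⟨l₂, φ₂, hφ₂⟩ := hY.exists_comp_eq_overDiagram H' (k := m) (h' := h')
    (G' ≫ G ≫ pullback.snd _ _) (pullback.snd _ _)
    (by rw [Category.assoc, Category.assoc, ← pullback.condition, reassoc_of% hGf,
      reassoc_of% hGf']) rfl (by rw [reassoc_of% hG', reassoc_of% hG])
  obtain ⟨n, ψ₁, ψ₂, hψ⟩ := IsCofiltered.cospan φ₁ φ₂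
  refine ⟨n, ⟨overHom (ψ₁ ≫ φ₁) G hGf, overHom (ψ₁ ≫ φ₁) G' hGf', ?_, ?_⟩,
    overHom_fst (ψ₁ ≫ φ₁) G hGf, ?_⟩
  · apply overHom_comp_overHom
    rw [Functor.map_comp, Category.assoc, hφ₁, Category.assoc]
  · apply overHom_comp_overHom
    rw [hψ, Functor.map_comp, Category.assoc, hφ₂, Category.assoc]
  · apply pullback.hom_ext
    · rw [Category.assoc, overHom_fst, pullback.lift_fst, pullback.lift_fst]
    · change overπ hY H n ≫ overHom _ G hGf ≫ _ = _
      rw [overHom, pullback.lift_snd, reassoc_of% overπ_map hY H, reassoc_of% hG]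
      simp

end

end

end CoveringSpace

/-! ### Schemes finite étale over an open subscheme, and their gluing. -/

namespace CoveringSpace

section

variable {C : Type*} [Category* C]

lemma isPullback_comp_mono {P X Y Z Z' : C} {a : P ⟶ X} {b : P ⟶ Y} {f : X ⟶ Z} {g : Y ⟶ Z}
    {m : Z ⟶ Z'} [Mono m] : IsPullback a b (f ≫ m) (g ≫ m) ↔ IsPullback a b f g := by
  refine ⟨fun h ↦ ?_, fun h ↦ ?_⟩
  · exact ⟨⟨by simpa [← cancel_mono m] using h.w⟩, ⟨PullbackCone.IsLimit.mk _
      (fun s ↦ h.lift s.fst s.snd (by simp [s.condition_assoc])) (by simp) (by simp)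
      (fun s k h1 h2 ↦ h.hom_ext (by simpa using h1) (by simpa using h2))⟩⟩
  · exact ⟨⟨by simp [h.w_assoc]⟩, ⟨PullbackCone.IsLimit.mk _
      (fun s ↦ h.lift s.fst s.snd (by simpa [← cancel_mono m] using s.condition)) (by simp)
      (by simp) (fun s k h1 h2 ↦ h.hom_ext (by simpa using h1) (by simpa using h2))⟩⟩

end

variable {S T E E' P : Scheme.{u}}

/-- Over the inverse image of an open subset of the target, a morphism may be replaced by its
restriction. -/
lemma isPullback_restrict_iff {O : S.Opens} {h : E ⟶ S} {g : T ⟶ S} (hg : ∀ x, g x ∈ O)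
    {j : E' ⟶ E} [IsOpenImmersion j] (hj : h ⁻¹ᵁ O ≤ j.opensRange) {a : P ⟶ E'} {b : P ⟶ T} :
    IsPullback (a ≫ j) b h g ↔ IsPullback a b (j ≫ h) g := by
  refine ⟨fun H ↦ ?_, fun H ↦ ?_⟩
  · refine ⟨⟨by simpa using H.w⟩, ⟨PullbackCone.IsLimit.mk _
      (fun s ↦ H.lift (s.fst ≫ j) s.snd (by simpa using s.condition)) (fun s ↦ ?_) (by simp)
      (fun s k h1 h2 ↦ H.hom_ext ?_ (by simpa using h2))⟩⟩
    · rw [← cancel_mono j, Category.assoc, IsPullback.lift_fst]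
    · rw [IsPullback.lift_fst, ← h1, Category.assoc]
  · have hr (s : PullbackCone h g) : Set.range s.fst ⊆ Set.range j := by
      rintro _ ⟨x, rfl⟩
      refine hj ?_
      change h (s.fst x) ∈ O
      rw [← Scheme.Hom.comp_apply, s.condition, Scheme.Hom.comp_apply]
      exact hg _
    refine ⟨⟨by simpa using H.w⟩, ⟨PullbackCone.IsLimit.mk _
      (fun s ↦ H.lift (IsOpenImmersion.lift j s.fst (hr s)) s.snd
        (by rw [IsOpenImmersion.lift_fac_assoc, s.condition])) (fun s ↦ ?_) (by simp)
      (fun s k h1 h2 ↦ H.hom_ext ?_ (by simpa using h2))⟩⟩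
    · rw [IsPullback.lift_fst_assoc, IsOpenImmersion.lift_fac]
    · rw [IsPullback.lift_fst, ← cancel_mono j, IsOpenImmersion.lift_fac, ← h1, Category.assoc]

/-- A morphism which is the composition of a finite étale morphism to an open subscheme and
the inclusion. -/
structure IsFiniteEtaleOver (O : S.Opens) (h : E ⟶ S) : Prop where
  mem : ∀ x, h x ∈ O
  of_isPullback : ∀ {P T : Scheme.{u}} {a : P ⟶ E} {b : P ⟶ T} {g : T ⟶ S}, (∀ x, g x ∈ O) →
    IsPullback a b h g → IsFinite b ∧ Etale b

lemma IsFiniteEtaleOver.of_isFinite {V : Scheme.{u}} (h : E ⟶ V) [IsFinite h] [Etale h]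
    (j : V ⟶ S) [IsOpenImmersion j] : IsFiniteEtaleOver j.opensRange (h ≫ j) where
  mem x := by
    rw [Scheme.Hom.comp_apply]
    exact ⟨_, rfl⟩
  of_isPullback {P T a b g} hg H := by
    let g' : T ⟶ V := IsOpenImmersion.lift j g (by
      rintro _ ⟨x, rfl⟩
      exact hg x)
    have hg' : g' ≫ j = g := IsOpenImmersion.lift_fac _ _ _
    rw [← hg', isPullback_comp_mono] at H
    exact ⟨MorphismProperty.of_isPullback (P := @IsFinite) H ‹_›,
      MorphismProperty.of_isPullback (P := @Etale) H ‹_›⟩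

lemma IsFiniteEtaleOver.exists_fac {O : S.Opens} {h : E ⟶ S} (H : IsFiniteEtaleOver O h) :
    ∃ h₀ : E ⟶ O, IsFinite h₀ ∧ Etale h₀ ∧ h₀ ≫ O.ι = h := by
  let h₀ : E ⟶ O := IsOpenImmersion.lift O.ι h (by
    rintro _ ⟨x, rfl⟩
    simpa using H.mem x)
  have hh : h₀ ≫ O.ι = h := IsOpenImmersion.lift_fac _ _ _
  have sq : IsPullback (𝟙 E) h₀ (h₀ ≫ O.ι) (𝟙 _ ≫ O.ι) :=
    isPullback_comp_mono.mpr (.of_horiz_isIso ⟨by simp⟩)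
  rw [hh, Category.id_comp] at sq
  obtain ⟨h1, h2⟩ := H.of_isPullback (fun x : (O : Scheme.{u}) ↦ x.2) sq
  exact ⟨h₀, h1, h2, hh⟩

lemma IsFiniteEtaleOver.top {h : E ⟶ S} (H : IsFiniteEtaleOver ⊤ h) : IsFinite h ∧ Etale h :=
  H.of_isPullback (a := 𝟙 E) (g := 𝟙 S) (fun _ ↦ trivial) (.of_horiz_isIso ⟨by simp⟩)

lemma IsFiniteEtaleOver.baseChange {O : S.Opens} {h : E ⟶ S} (H : IsFiniteEtaleOver O h)
    {h' : E' ⟶ T} {g : T ⟶ S} {a : E' ⟶ E} (sq : IsPullback a h' h g) :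
    IsFiniteEtaleOver (g ⁻¹ᵁ O) h' where
  mem x := by
    change g (h' x) ∈ O
    rw [← Scheme.Hom.comp_apply, ← sq.w, Scheme.Hom.comp_apply]
    exact H.mem _
  of_isPullback {P T a b g'} hg sq' := by
    refine H.of_isPullback (fun x ↦ ?_) (sq'.paste_horiz sq)
    rw [Scheme.Hom.comp_apply]
    exact hg x

lemma IsFiniteEtaleOver.restrict {O O' : S.Opens} {h : E ⟶ S} (H : IsFiniteEtaleOver O h)
    (hO : O' ≤ O) : IsFiniteEtaleOver O' ((h ⁻¹ᵁ O').ι ≫ h) where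
  mem x := by
    rw [Scheme.Hom.comp_apply]
    exact x.2
  of_isPullback hg sq :=
    H.of_isPullback (fun x ↦ hO (hg x)) ((isPullback_restrict_iff hg (by simp)).mpr sq)

section Glue

variable {E₁ E₂ E₁₂ : Scheme.{u}}

/-- Gluing of two schemes along open subschemes. -/
lemma exists_pushout_isOpenImmersion (a : E₁₂ ⟶ E₁) (b : E₁₂ ⟶ E₂) [IsOpenImmersion a]
    [IsOpenImmersion b] :
    ∃ (E : Scheme.{u}) (i₁ : E₁ ⟶ E) (i₂ : E₂ ⟶ E), IsOpenImmersion i₁ ∧ IsOpenImmersion i₂ ∧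
      IsPushout a b i₁ i₂ ∧ ∀ x, x ∈ Set.range i₁ ∨ x ∈ Set.range i₂ := by
  have {i j : WalkingSpan} (f : i ⟶ j) : IsOpenImmersion ((span a b).map f) := by
    rcases f with _ | (_ | _)
    · rw [show (WidePushoutShape.Hom.id i) = 𝟙 i from rfl, CategoryTheory.Functor.map_id]
      infer_instance
    · exact ‹IsOpenImmersion a›
    · exact ‹IsOpenImmersion b›
  have : (span a b ⋙ Scheme.forget).IsLocallyDirected := inferInstance
  have : HasPushout a b := inferInstanceAs (HasColimit (span a b))
  refine ⟨pushout a b, pushout.inl a b, pushout.inr a b,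
    inferInstanceAs (IsOpenImmersion (colimit.ι (span a b) WalkingSpan.left)),
    inferInstanceAs (IsOpenImmersion (colimit.ι (span a b) WalkingSpan.right)),
    IsPushout.of_hasPushout a b, fun x ↦ ?_⟩
  obtain ⟨i, y, hy⟩ := Scheme.IsLocallyDirected.ι_jointly_surjective (span a b) x
  rcases i with _ | (_ | _)
  · refine Or.inl ⟨a y, ?_⟩
    have e : a ≫ pushout.inl a b = colimit.ι (span a b) WalkingSpan.zero :=
      colimit.w (span a b) WalkingSpan.Hom.fst
    rw [← hy]
    exact congr($e y)
  · exact Or.inl ⟨y, hy⟩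
  · exact Or.inr ⟨y, hy⟩

variable {h : E ⟶ S} {i₁ : E₁ ⟶ E} {i₂ : E₂ ⟶ E} [IsOpenImmersion i₁] [IsOpenImmersion i₂]
  {O₁ O₂ : S.Opens}

/-- Over the preimages of `O₁` and `O₂` a base change of `h` is a base change of one of the pieces,
and finiteness and étaleness are local on the target. -/
lemma IsFiniteEtaleOver.glue (h₁ : IsFiniteEtaleOver O₁ (i₁ ≫ h))
    (h₂ : IsFiniteEtaleOver O₂ (i₂ ≫ h))
    (hi : ∀ x, x ∈ Set.range i₁ ∨ x ∈ Set.range i₂) (hi₁ : h ⁻¹ᵁ O₁ ≤ i₁.opensRange)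
    (hi₂ : h ⁻¹ᵁ O₂ ≤ i₂.opensRange) : IsFiniteEtaleOver (O₁ ⊔ O₂) h where
  mem x := by
    rcases hi x with ⟨y, rfl⟩ | ⟨y, rfl⟩
    · rw [← Scheme.Hom.comp_apply]
      exact Or.inl (h₁.mem y)
    · rw [← Scheme.Hom.comp_apply]
      exact Or.inr (h₂.mem y)
  of_isPullback {P T a b g} hg sq := by
    have aux {E' : Scheme.{u}} {i : E' ⟶ E} [IsOpenImmersion i] {O : S.Opens}
        (h' : IsFiniteEtaleOver O (i ≫ h)) (hi : h ⁻¹ᵁ O ≤ i.opensRange) :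
        IsFinite (b ∣_ (g ⁻¹ᵁ O)) ∧ Etale (b ∣_ (g ⁻¹ᵁ O)) := by
      have hgO (x : ((g ⁻¹ᵁ O : T.Opens) : Scheme.{u})) : ((g ⁻¹ᵁ O).ι ≫ g) x ∈ O := by
        rw [Scheme.Hom.comp_apply]
        exact x.2
      have sq' := (isPullback_morphismRestrict b (g ⁻¹ᵁ O)).flip.paste_horiz sq
      let a' : ((b ⁻¹ᵁ g ⁻¹ᵁ O : P.Opens) : Scheme.{u}) ⟶ E' :=
        IsOpenImmersion.lift i ((b ⁻¹ᵁ g ⁻¹ᵁ O).ι ≫ a) (by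
          rintro _ ⟨x, rfl⟩
          refine hi ?_
          change h _ ∈ O
          rw [← Scheme.Hom.comp_apply, sq'.w, Scheme.Hom.comp_apply]
          exact hgO _)
      have ha' : a' ≫ i = (b ⁻¹ᵁ g ⁻¹ᵁ O).ι ≫ a := IsOpenImmersion.lift_fac _ _ _
      rw [← ha', isPullback_restrict_iff hgO hi] at sq'
      exact h'.of_isPullback hgO sq'
    have htop : ⨆ k : Bool, g ⁻¹ᵁ (bif k then O₁ else O₂) = ⊤ := by
      rw [iSup_bool_eq]
      exact top_le_iff.mp fun x _ ↦ hg x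
    have : IsZariskiLocalAtTarget @IsFinite.{u} :=
      @HasAffineProperty.instIsZariskiLocalAtTarget _ _
        IsFinite.instHasAffinePropertyAndIsAffineFiniteCarrierObjOppositeOpensCarrierCarrierCommRingCatPresheafOpOpensTopHomAppTop
    have : IsZariskiLocalAtTarget @Etale.{u} :=
      @HasAffineProperty.instIsZariskiLocalAtTarget _ _
        (HasRingHomProperty.HasAffineProperty @Etale.{u} (Q := RingHom.Etale))
    constructor
    · refine IsZariskiLocalAtTarget.of_iSup_eq_top (P := @IsFinite) _ htop fun k ↦ ?_
      cases k
      · exact (aux h₂ hi₂).1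
      · exact (aux h₁ hi₁).1
    · refine IsZariskiLocalAtTarget.of_iSup_eq_top (P := @Etale) _ htop fun k ↦ ?_
      cases k
      · exact (aux h₂ hi₂).2
      · exact (aux h₁ hi₁).2

/-- The open cover given by two jointly surjective open immersions. -/
abbrev openCoverOfTwo (i₁ : E₁ ⟶ E) (i₂ : E₂ ⟶ E) [IsOpenImmersion i₁] [IsOpenImmersion i₂]
    (hi : ∀ x, x ∈ Set.range i₁ ∨ x ∈ Set.range i₂) : E.OpenCover :=
  Scheme.Cover.mkOfCovers Bool (fun k ↦ match k with | true => E₁ | false => E₂)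
    (fun k ↦ match k with | true => i₁ | false => i₂)
    (fun x ↦ by
      rcases hi x with ⟨y, hy⟩ | ⟨y, hy⟩
      · exact ⟨true, y, hy⟩
      · exact ⟨false, y, hy⟩)
    (fun k ↦ by cases k <;> assumption)

/-- A square is cartesian if it is so over the members of an open cover. -/
lemma isPullback_glue (hi : ∀ x, x ∈ Set.range i₁ ∨ x ∈ Set.range i₂)
    {W Y W₁ W₂ : Scheme.{u}} {q : W ⟶ E} {w : W ⟶ Y} {π : Y ⟶ S} {j₁ : W₁ ⟶ W} {j₂ : W₂ ⟶ W}
    [IsOpenImmersion j₁] [IsOpenImmersion j₂] {q₁ : W₁ ⟶ E₁} {q₂ : W₂ ⟶ E₂}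
    (w₁ : j₁ ≫ q = q₁ ≫ i₁) (w₂ : j₂ ≫ q = q₂ ≫ i₂) (hj₁ : q ⁻¹ᵁ i₁.opensRange = j₁.opensRange)
    (hj₂ : q ⁻¹ᵁ i₂.opensRange = j₂.opensRange)
    (H₁ : IsPullback q₁ (j₁ ≫ w) (i₁ ≫ h) π) (H₂ : IsPullback q₂ (j₂ ≫ w) (i₂ ≫ h) π) :
    IsPullback q w h π := by
  have aux {E' W' : Scheme.{u}} {i : E' ⟶ E} {j : W' ⟶ W} [IsOpenImmersion i] [IsOpenImmersion j]
      {q' : W' ⟶ E'} (w' : j ≫ q = q' ≫ i) (hj : q ⁻¹ᵁ i.opensRange = j.opensRange)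
      (H : IsPullback q' (j ≫ w) (i ≫ h) π) :
      IsPullback (pullback.snd q i) (pullback.fst q i ≫ w) (i ≫ h) π := by
    have sq : IsPullback j q' q i := (IsOpenImmersion.isPullback q' j i q w' hj).flip
    refine H.of_iso sq.isoPullback (Iso.refl _) (Iso.refl _) (Iso.refl _) ?_ ?_ ?_ ?_ <;> simp
  refine Scheme.isPullback_of_openCover _ _ _ _ (openCoverOfTwo i₁ i₂ hi) fun k ↦ ?_
  cases k
  · exact aux (i := i₂) (j := j₂) w₂ hj₂ H₂
  · exact aux (i := i₁) (j := j₁) w₁ hj₁ H₁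

/-- Morphisms glue along two jointly surjective open immersions. -/
lemma exists_glue_hom (hi : ∀ x, x ∈ Set.range i₁ ∨ x ∈ Set.range i₂) {a : P ⟶ E₁} {b : P ⟶ E₂}
    (sq : IsPullback a b i₁ i₂) (f : E₁ ⟶ T) (g : E₂ ⟶ T) (hfg : a ≫ f = b ≫ g) :
    ∃ q : E ⟶ T, i₁ ≫ q = f ∧ i₂ ≫ q = g := by
  let 𝒰 := openCoverOfTwo i₁ i₂ hi
  let φ (k : Bool) : 𝒰.X k ⟶ T := match k with | true => f | false => g
  have key : pullback.fst i₁ i₂ ≫ f = pullback.snd i₁ i₂ ≫ g := by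
    rw [← cancel_epi sq.isoPullback.hom]
    simpa using hfg
  have key' : pullback.fst i₂ i₁ ≫ g = pullback.snd i₂ i₁ ≫ f := by
    rw [← cancel_epi sq.flip.isoPullback.hom]
    simpa using hfg.symm
  have hφ (k l : Bool) : pullback.fst (𝒰.f k) (𝒰.f l) ≫ φ k = pullback.snd (𝒰.f k) (𝒰.f l) ≫ φ l := by
    have hm {E' : Scheme.{u}} (i : E' ⟶ E) [IsOpenImmersion i] (f : E' ⟶ T) :
        pullback.fst i i ≫ f = pullback.snd i i ≫ f := by
      rw [(cancel_mono i).mp pullback.condition]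
    cases k <;> cases l
    · exact hm i₂ g
    · exact key'
    · exact key
    · exact hm i₁ f
  exact ⟨Scheme.Cover.glueMorphisms 𝒰 φ hφ, Scheme.Cover.ι_glueMorphisms 𝒰 φ hφ true,
    Scheme.Cover.ι_glueMorphisms 𝒰 φ hφ false⟩

end Glue

end CoveringSpace

namespace CoveringSpace

section

variable {S Y W E₁ E₂ E₁₂ : Scheme.{u}} {π : Y ⟶ S} {w : W ⟶ Y} {O₁ O₂ : S.Opens}

lemma mem_range_homOfLE {A B : W.Opens} (h : A ≤ B) (x : (B : Scheme.{u})) :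
    x ∈ Set.range (W.homOfLE h) ↔ B.ι x ∈ A := by
  rw [← Scheme.Hom.coe_opensRange, Scheme.opensRange_homOfLE]
  rfl

/-- Gluing of two finite étale schemes over open subschemes, compatibly with given base changes. -/
lemma exists_glue_isPullback {A₁ A₂ : W.Opens} (hA₁ : A₁ = (w ≫ π) ⁻¹ᵁ O₁)
    (hA₂ : A₂ = (w ≫ π) ⁻¹ᵁ O₂) {h₁ : E₁ ⟶ S} {h₂ : E₂ ⟶ S} (hh₁ : IsFiniteEtaleOver O₁ h₁)
    (hh₂ : IsFiniteEtaleOver O₂ h₂) {q₁ : (A₁ : Scheme.{u}) ⟶ E₁} {q₂ : (A₂ : Scheme.{u}) ⟶ E₂}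
    (sq₁ : IsPullback q₁ (A₁.ι ≫ w) h₁ π) (sq₂ : IsPullback q₂ (A₂.ι ≫ w) h₂ π)
    {a : E₁₂ ⟶ E₁} {b : E₁₂ ⟶ E₂} [IsOpenImmersion a] [IsOpenImmersion b]
    (hab : a ≫ h₁ = b ≫ h₂) (ha : h₁ ⁻¹ᵁ O₂ ≤ a.opensRange) (hb : h₂ ⁻¹ᵁ O₁ ≤ b.opensRange)
    {c : ((A₁ ⊓ A₂ : W.Opens) : Scheme.{u}) ⟶ E₁₂} (hc₁ : c ≫ a = W.homOfLE inf_le_left ≫ q₁)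
    (hc₂ : c ≫ b = W.homOfLE inf_le_right ≫ q₂) :
    ∃ (E : Scheme.{u}) (h : E ⟶ S) (q : ((A₁ ⊔ A₂ : W.Opens) : Scheme.{u}) ⟶ E),
      IsFiniteEtaleOver (O₁ ⊔ O₂) h ∧ IsPullback q ((A₁ ⊔ A₂).ι ≫ w) h π := by
  obtain ⟨E, i₁, i₂, _, _, hE, hi⟩ := exists_pushout_isOpenImmersion a b
  obtain ⟨h, rfl, rfl⟩ : ∃ h : E ⟶ S, i₁ ≫ h = h₁ ∧ i₂ ≫ h = h₂ :=
    ⟨hE.desc h₁ h₂ hab, hE.inl_desc _ _ _, hE.inr_desc _ _ _⟩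
  -- The part of `E₂` over `O₁` lies in the image of `b`, so it has been identified with a part of
  -- `E₁`.
  have hi₁ : h ⁻¹ᵁ O₁ ≤ i₁.opensRange := by
    intro x hx
    rcases hi x with ⟨y, rfl⟩ | ⟨y, rfl⟩
    · exact ⟨y, rfl⟩
    · obtain ⟨z, rfl⟩ := hb (show y ∈ (i₂ ≫ h) ⁻¹ᵁ O₁ by
        change (i₂ ≫ h) y ∈ O₁
        rw [Scheme.Hom.comp_apply]
        exact hx)
      exact ⟨a z, by rw [← Scheme.Hom.comp_apply, hE.w, Scheme.Hom.comp_apply]⟩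
  have hi₂ : h ⁻¹ᵁ O₂ ≤ i₂.opensRange := by
    intro x hx
    rcases hi x with ⟨y, rfl⟩ | ⟨y, rfl⟩
    · obtain ⟨z, rfl⟩ := ha (show y ∈ (i₁ ≫ h) ⁻¹ᵁ O₂ by
        change (i₁ ≫ h) y ∈ O₂
        rw [Scheme.Hom.comp_apply]
        exact hx)
      exact ⟨b z, by rw [← Scheme.Hom.comp_apply, ← hE.w, Scheme.Hom.comp_apply]⟩
    · exact ⟨y, rfl⟩
  let j₁ := W.homOfLE (le_sup_left : A₁ ≤ A₁ ⊔ A₂)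
  let j₂ := W.homOfLE (le_sup_right : A₂ ≤ A₁ ⊔ A₂)
  have e₁ : j₁ ≫ (A₁ ⊔ A₂).ι = A₁.ι := W.homOfLE_ι _
  have e₂ : j₂ ≫ (A₁ ⊔ A₂).ι = A₂.ι := W.homOfLE_ι _
  have hj (x : ((A₁ ⊔ A₂ : W.Opens) : Scheme.{u})) : x ∈ Set.range j₁ ∨ x ∈ Set.range j₂ := by
    rcases x.2 with hx | hx
    · exact Or.inl ((mem_range_homOfLE _ x).mpr hx)
    · exact Or.inr ((mem_range_homOfLE _ x).mpr hx)
  obtain ⟨q, hq₁, hq₂⟩ := exists_glue_hom hj (isPullback_opens_inf_le _ _) (q₁ ≫ i₁) (q₂ ≫ i₂)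
    (by rw [← reassoc_of% hc₁, ← reassoc_of% hc₂, hE.w])
  have hqw : q ≫ h = ((A₁ ⊔ A₂).ι ≫ w) ≫ π := by
    refine Scheme.Cover.hom_ext (openCoverOfTwo j₁ j₂ hj) _ _ fun k ↦ ?_
    cases k
    · change j₂ ≫ q ≫ h = j₂ ≫ _
      rw [reassoc_of% hq₂, sq₂.w, Category.assoc, Category.assoc, reassoc_of% e₂]
    · change j₁ ≫ q ≫ h = j₁ ≫ _
      rw [reassoc_of% hq₁, sq₁.w, Category.assoc, Category.assoc, reassoc_of% e₁]
  have hmem (x : ((A₁ ⊔ A₂ : W.Opens) : Scheme.{u})) : (w ≫ π) ((A₁ ⊔ A₂).ι x) = h (q x) := by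
    rw [← Scheme.Hom.comp_apply, ← Scheme.Hom.comp_apply, hqw, Category.assoc]
  refine ⟨E, h, q, hh₁.glue hh₂ hi hi₁ hi₂,
    isPullback_glue hi (j₁ := j₁) (j₂ := j₂) hq₁ hq₂ ?_ ?_ ?_ ?_⟩
  · ext x
    constructor
    · rintro ⟨y, hy⟩
      refine (mem_range_homOfLE _ x).mpr (hA₁.ge ?_)
      change (w ≫ π) _ ∈ O₁
      rw [hmem, ← hy, ← Scheme.Hom.comp_apply]
      exact hh₁.mem y
    · rintro ⟨y, rfl⟩
      refine ⟨q₁ y, ?_⟩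
      rw [← Scheme.Hom.comp_apply, ← hq₁, Scheme.Hom.comp_apply]
  · ext x
    constructor
    · rintro ⟨y, hy⟩
      refine (mem_range_homOfLE _ x).mpr (hA₂.ge ?_)
      change (w ≫ π) _ ∈ O₂
      rw [hmem, ← hy, ← Scheme.Hom.comp_apply]
      exact hh₂.mem y
    · rintro ⟨y, rfl⟩
      refine ⟨q₂ y, ?_⟩
      rw [← Scheme.Hom.comp_apply, ← hq₂, Scheme.Hom.comp_apply]
  · rwa [reassoc_of% e₁]
  · rwa [reassoc_of% e₂]

/-- A cartesian square restricts to the inverse image of an open subset. -/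
lemma exists_isPullback_restrict {A B : W.Opens} (hBA : B ≤ A) {O' : S.Opens}
    (hB : B = A ⊓ (w ≫ π) ⁻¹ᵁ O') {h : E₁ ⟶ S} {q : (A : Scheme.{u}) ⟶ E₁}
    (sq : IsPullback q (A.ι ≫ w) h π) :
    ∃ q' : (B : Scheme.{u}) ⟶ ((h ⁻¹ᵁ O' : E₁.Opens) : Scheme.{u}),
      q' ≫ (h ⁻¹ᵁ O').ι = W.homOfLE hBA ≫ q ∧ IsPullback q' (B.ι ≫ w) ((h ⁻¹ᵁ O').ι ≫ h) π := by
  have hmem (x : (A : Scheme.{u})) : (w ≫ π) (A.ι x) = h (q x) := by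
    rw [← Scheme.Hom.comp_apply, ← Scheme.Hom.comp_apply, sq.w, Category.assoc]
  let q' : (B : Scheme.{u}) ⟶ ((h ⁻¹ᵁ O' : E₁.Opens) : Scheme.{u}) :=
    IsOpenImmersion.lift (h ⁻¹ᵁ O').ι (W.homOfLE hBA ≫ q) (by
      rintro _ ⟨x, rfl⟩
      have hx : (w ≫ π) (B.ι x) ∈ O' := (hB.le x.2).2
      have e : B.ι x = A.ι (W.homOfLE hBA x) := by rw [← Scheme.Hom.comp_apply, W.homOfLE_ι]
      rw [e, hmem, ← Scheme.Hom.comp_apply] at hx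
      simpa using hx)
  have hq' : q' ≫ (h ⁻¹ᵁ O').ι = W.homOfLE hBA ≫ q := IsOpenImmersion.lift_fac _ _ _
  refine ⟨q', hq', ?_⟩
  have sq' : IsPullback q' (W.homOfLE hBA) (h ⁻¹ᵁ O').ι q := by
    refine IsOpenImmersion.isPullback _ _ _ _ hq'.symm ?_
    ext x
    simp only [Scheme.Opens.opensRange_ι]
    refine Iff.trans ?_ (mem_range_homOfLE hBA x).symm
    change h (q x) ∈ O' ↔ _
    rw [← hmem]
    exact ⟨fun hx ↦ hB.ge ⟨x.2, hx⟩, fun hx ↦ (hB.le hx).2⟩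
  simpa using sq'.paste_vert sq

end

end CoveringSpace

/-! ### Finite étale schemes over the limit come from a finite level. -/

namespace CoveringSpace

variable {J : Type u} [SmallCategory J] {D : J ⥤ Scheme.{u}} {X Y W : Scheme.{u}}
  {π : ∀ j, Y ⟶ D.obj j} {t : ∀ j, D.obj j ⟶ X} {p : Y ⟶ X} {w : W ⟶ Y}

/-- Over the open subset `U` of `X`, the scheme `W` over the limit `Y` of `D` is the base change of
a finite étale scheme over `D.obj i`. -/
def DescendsOver (D : J ⥤ Scheme.{u}) (π : ∀ j, Y ⟶ D.obj j) (t : ∀ j, D.obj j ⟶ X) (w : W ⟶ Y)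
    (A : W.Opens) (U : X.Opens) (i : J) : Prop :=
  ∃ (E : Scheme.{u}) (h : E ⟶ D.obj i) (q : (A : Scheme.{u}) ⟶ E),
    IsFiniteEtaleOver (t i ⁻¹ᵁ U) h ∧ IsPullback q (A.ι ≫ w) h (π i)

lemma DescendsOver.of_hom (hY : IsLimitCone D Y π)
    (ht : ∀ {i j : J} (φ : i ⟶ j), D.map φ ≫ t j = t i) {A : W.Opens} {U : X.Opens} {i j : J}
    (φ : j ⟶ i) (H : DescendsOver D π t w A U i) : DescendsOver D π t w A U j := by
  obtain ⟨E, h, q, hh, sq⟩ := H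
  have sq' : IsPullback (pullback.lift q ((A.ι ≫ w) ≫ π j) (by rw [Category.assoc, hY.w, sq.w]))
      (A.ι ≫ w) (pullback.snd h (D.map φ)) (π j) := by
    refine IsPullback.of_right (h₁₂ := pullback.fst h (D.map φ)) (h₂₂ := D.map φ) (v₁₃ := h) ?_ ?_
      (IsPullback.of_hasPullback _ _)
    · simpa [hY.w] using sq
    · simp
  refine ⟨_, pullback.snd h (D.map φ), _, ?_, sq'⟩
  have := hh.baseChange (IsPullback.of_hasPullback h (D.map φ))
  rwa [← Scheme.Hom.comp_preimage, ht] at this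

/-- Over an affine open the limit is affine, so the finite étale scheme is pulled back from some `T
⟶ S` with `S` of finite presentation over the integers. The morphism from the limit to `S` factors
through a finite level, over which `T` is pulled back. -/
lemma DescendsOver.of_isAffineOpen [IsCofiltered J] (hY : IsLimitCone D Y π)
    (ht : ∀ {i j : J} (φ : i ⟶ j), D.map φ ≫ t j = t i)
    (hfin : ∀ j, IsFinite (t j)) (hp : ∀ j, π j ≫ t j = p)
    [IsFinite w] [Etale w] {U : X.Opens} (hU : IsAffineOpen U) :
    ∃ i, DescendsOver D π t w ((w ≫ p) ⁻¹ᵁ U) U i := by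
  have : IsConnected J := IsCofiltered.isConnected J
  have : IsAffine U := hU
  have haff (j : J) : IsAffine ((pullbackDiagram D t ht U.ι).obj j) :=
    isAffine_of_isAffineHom (pullback.snd (t j) U.ι)
  have hD {i j : J} (φ : i ⟶ j) : IsAffineHom ((pullbackDiagram D t ht U.ι).map φ) :=
    inferInstance
  have sqU : IsPullback (p ⁻¹ᵁ U).ι (p ∣_ U) p U.ι := (isPullback_morphismRestrict p U).flip
  have hYU := hY.baseChange ht U.ι hp sqU
  have hYaff : IsAffine (p ⁻¹ᵁ U) := Scheme.isAffine_of_isLimit _ hYU.isLimit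
  obtain ⟨S, T, f, a, b, hS, hf, hf', sq⟩ := exists_isPullback_of_isAffine (w ∣_ (p ⁻¹ᵁ U))
  obtain ⟨i, g, hg, -⟩ := hYU.exists_fac (specULiftZIsTerminal.{u}.from S)
    (t := fun _ ↦ specULiftZIsTerminal.{u}.from _) (fun _ ↦ specULiftZIsTerminal.{u}.hom_ext _ _) a
    (fun _ ↦ specULiftZIsTerminal.{u}.hom_ext _ _)
  let l : ((p ⁻¹ᵁ U : Y.Opens) : Scheme.{u}) ⟶ pullback (t i) U.ι :=
    pullback.lift ((p ⁻¹ᵁ U).ι ≫ π i) (p ∣_ U) (by rw [Category.assoc, hp, sqU.w])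
  have hlg : l ≫ g = a := hg
  have sq₁ : IsPullback (pullback.lift b (w ∣_ (p ⁻¹ᵁ U) ≫ l) (by
      rw [Category.assoc, hlg, sq.w])) (w ∣_ (p ⁻¹ᵁ U)) (pullback.snd f g) l := by
    refine IsPullback.of_right (h₁₂ := pullback.fst f g) (h₂₂ := g) (v₁₃ := f) ?_ ?_
      (IsPullback.of_hasPullback _ _)
    · simpa [hlg] using sq
    · simp
  have sq₂ : IsPullback l (p ⁻¹ᵁ U).ι (pullback.fst (t i) U.ι) (π i) := by
    refine IsPullback.of_right (h₁₂ := pullback.snd (t i) U.ι) (h₂₂ := t i) (v₁₃ := U.ι) ?_ ?_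
      (IsPullback.of_hasPullback _ _).flip
    · simpa [l, hp] using sqU.flip
    · simp [l]
  have sq₃ := sq₁.paste_vert sq₂
  rw [morphismRestrict_ι] at sq₃
  have hE := IsFiniteEtaleOver.of_isFinite (pullback.snd f g) (pullback.fst (t i) U.ι)
  rw [Scheme.Hom.opensRange_pullbackFst, Scheme.Opens.opensRange_ι] at hE
  exact ⟨i, _, _, _, hE, sq₃⟩

/-- These are the finiteness conditions needed to spread out an isomorphism over an overlap. -/
lemma IsFiniteEtaleOver.compactSpace_and_quasiSeparatedSpace [QuasiSeparatedSpace X]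
    {S E : Scheme.{u}} {f : S ⟶ X} [IsFinite f] {U : X.Opens} (hU : IsCompact (U : Set X))
    {h : E ⟶ S} (hh : IsFiniteEtaleOver (f ⁻¹ᵁ U) h) :
    CompactSpace E ∧ QuasiSeparatedSpace E ∧ LocallyOfFinitePresentation h := by
  obtain ⟨h₀, _, _, rfl⟩ := hh.exists_fac
  have : CompactSpace (f ⁻¹ᵁ U) := isCompact_iff_compactSpace.mp (f.isCompact_preimage hU)
  have : QuasiSeparatedSpace S := quasiSeparatedSpace_of_quasiSeparated f
  have : QuasiSeparatedSpace (f ⁻¹ᵁ U) := quasiSeparatedSpace_of_quasiSeparated (f ⁻¹ᵁ U).ι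
  exact ⟨QuasiCompact.compactSpace_of_compactSpace h₀, quasiSeparatedSpace_of_quasiSeparated h₀,
    inferInstance⟩

lemma isPullback_overπ (hY : IsLimitCone D Y π) {E Q : Scheme.{u}} {i : J} {h : E ⟶ D.obj i}
    {q : Q ⟶ E} {w : Q ⟶ Y} (H : IsPullback q w h (π i)) (k : Over i) :
    IsPullback (overπ hY H k) w (pullback.fst (toBase D k) h) (π k.left) := by
  refine IsPullback.of_right (h₁₂ := pullback.snd (toBase D k) h) (h₂₂ := toBase D k) (v₁₃ := h)
    ?_ ?_ (IsPullback.of_hasPullback _ _).flip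
  · simpa [hY.w_toBase] using H
  · simp

section

variable {S T E E' : Scheme.{u}} (g : T ⟶ S) (i : E' ⟶ E) (h : E ⟶ S)

/-- The base change along `g` of the morphism `i` over `S`. -/
noncomputable abbrev pullbackOverMap : pullback g (i ≫ h) ⟶ pullback g h :=
  pullback.lift (pullback.fst _ _) (pullback.snd _ _ ≫ i) (by
    rw [pullback.condition, Category.assoc])

lemma isPullback_pullbackOverMap :
    IsPullback (pullbackOverMap g i h) (pullback.snd _ _) (pullback.snd _ _) i := by
  refine IsPullback.of_right (h₁₂ := pullback.fst g h) (h₂₂ := h) (v₁₃ := g) ?_ ?_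
    (IsPullback.of_hasPullback _ _)
  · simpa using IsPullback.of_hasPullback g (i ≫ h)
  · simp

instance [IsOpenImmersion i] : IsOpenImmersion (pullbackOverMap g i h) :=
  MorphismProperty.of_isPullback (P := @IsOpenImmersion) (isPullback_pullbackOverMap g i h).flip ‹_›

lemma mem_range_pullbackOverMap {x : ↥(pullback g h)} (hx : pullback.snd g h x ∈ Set.range i) :
    x ∈ Set.range (pullbackOverMap g i h) := by
  obtain ⟨y, hy⟩ := hx
  obtain ⟨z, hz, -⟩ := Scheme.Pullback.exists_preimage_pullback x y hy.symm
  have e := (isPullback_pullbackOverMap g i h).isoPullback_inv_fst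
  exact ⟨(isPullback_pullbackOverMap g i h).isoPullback.inv z, by
    rw [← Scheme.Hom.comp_apply, e, hz]⟩

end

/-- Gluing of finite étale schemes over two open subsets of `X`, after raising the level. -/
lemma DescendsOver.sup [IsCofiltered J] [QuasiSeparatedSpace X] (hY : IsLimitCone D Y π)
    (ht : ∀ {i j : J} (φ : i ⟶ j), D.map φ ≫ t j = t i)
    (hfin : ∀ j, IsFinite (t j)) (hp : ∀ j, π j ≫ t j = p) {U V : X.Opens}
    (hUV : IsCompact ((U ⊓ V : X.Opens) : Set X)) {A₁ A₂ : W.Opens} (hA₁ : A₁ = (w ≫ p) ⁻¹ᵁ U)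
    (hA₂ : A₂ = (w ≫ p) ⁻¹ᵁ V) {i : J} (HU : DescendsOver D π t w A₁ U i)
    (HV : DescendsOver D π t w A₂ V i) : ∃ k, DescendsOver D π t w (A₁ ⊔ A₂) (U ⊔ V) k := by
  have haff {i j : J} (φ : i ⟶ j) : IsAffineHom (D.map φ) :=
    isAffineHom_map ht (fun j ↦ inferInstance) φ
  obtain ⟨E₁, h₁, q₁, hh₁, sq₁⟩ := HU
  obtain ⟨E₂, h₂, q₂, hh₂, sq₂⟩ := HV
  have hA (O : X.Opens) (j : J) : (w ≫ π j) ⁻¹ᵁ (t j ⁻¹ᵁ O) = (w ≫ p) ⁻¹ᵁ O := by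
    rw [← Scheme.Hom.comp_preimage, Category.assoc, hp]
  let O := t i ⁻¹ᵁ (U ⊓ V)
  obtain ⟨q₁', hq₁, sq₁'⟩ := exists_isPullback_restrict (B := A₁ ⊓ A₂) inf_le_left
    (O' := O)
    (by rw [hA, hA₁, hA₂]; exact le_antisymm (fun x hx ↦ ⟨hx.1, hx⟩) (fun x hx ↦ hx.2)) sq₁
  obtain ⟨q₂', hq₂, sq₂'⟩ := exists_isPullback_restrict (B := A₁ ⊓ A₂) inf_le_right
    (O' := O)
    (by rw [hA, hA₁, hA₂]; exact le_antisymm (fun x hx ↦ ⟨hx.2, hx⟩) (fun x hx ↦ hx.2)) sq₂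
  obtain ⟨_, _, _⟩ := (hh₁.restrict (O' := O)
    (fun x hx ↦ hx.1)).compactSpace_and_quasiSeparatedSpace hUV
  obtain ⟨_, _, _⟩ := (hh₂.restrict (O' := O)
    (fun x hx ↦ hx.2)).compactSpace_and_quasiSeparatedSpace hUV
  -- Over `U ⊓ V` both models have the same base change to `Y`, so they become isomorphic at some
  -- level `k`; this isomorphism is the gluing datum.
  obtain ⟨k, e, he, heρ⟩ := hY.exists_iso_overDiagram sq₁' sq₂'
  have htk : toBase D k ≫ t i = t k.left := ht k.hom
  have hk₁ := hh₁.baseChange (IsPullback.of_hasPullback (toBase D k) h₁).flip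
  have hk₂ := hh₂.baseChange (IsPullback.of_hasPullback (toBase D k) h₂).flip
  rw [← Scheme.Hom.comp_preimage, htk] at hk₁ hk₂
  let a₁ := pullbackOverMap (toBase D k) (h₁ ⁻¹ᵁ O).ι h₁
  let a₂ := pullbackOverMap (toBase D k) (h₂ ⁻¹ᵁ O).ι h₂
  have hmem {E : Scheme.{u}} (h : E ⟶ D.obj i) (x : ↥(pullback (toBase D k) h))
      (hx : t k.left (pullback.fst (toBase D k) h x) ∈ U ⊓ V) :
      x ∈ Set.range (pullbackOverMap (toBase D k) (h ⁻¹ᵁ O).ι h) := by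
    refine mem_range_pullbackOverMap _ _ _ ?_
    rw [Scheme.Opens.range_ι]
    change t i (h _) ∈ U ⊓ V
    rwa [← Scheme.Hom.comp_apply _ h, ← pullback.condition, Scheme.Hom.comp_apply,
      ← Scheme.Hom.comp_apply _ (t i), htk]
  have hρ₁ : overπ hY sq₁' k ≫ a₁ = W.homOfLE inf_le_left ≫ overπ hY sq₁ k := by
    apply pullback.hom_ext <;> simp [a₁, hq₁]
  have hρ₂ : overπ hY sq₂' k ≫ a₂ = W.homOfLE inf_le_right ≫ overπ hY sq₂ k := by
    apply pullback.hom_ext <;> simp [a₂, hq₂]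
  obtain ⟨E, h, q, hh, sq⟩ := exists_glue_isPullback (A₁ := A₁) (A₂ := A₂)
    (hA₁.trans (hA U k.left).symm)
    (hA₂.trans (hA V k.left).symm) hk₁ hk₂ (isPullback_overπ hY sq₁ k) (isPullback_overπ hY sq₂ k)
    (a := a₁) (b := e.hom ≫ a₂) (by simp [a₁, a₂, he])
    (fun x hx ↦ hmem h₁ x ⟨hk₁.mem x, hx⟩)
    (fun x hx ↦ by
      obtain ⟨y, hy⟩ := hmem h₂ x ⟨hx, hk₂.mem x⟩
      exact ⟨e.inv y, by rw [← Scheme.Hom.comp_apply, e.inv_hom_id_assoc, hy]⟩)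
    hρ₁ (by rw [reassoc_of% heρ, hρ₂])
  exact ⟨k.left, E, h, q, hh, sq⟩

/-- Finite étale schemes over a cofiltered limit of finite étale schemes over `X` come from a
finite level. -/
theorem IsLimitCone.exists_isPullback_of_finite_etale [IsCofiltered J] [QuasiSeparatedSpace X]
    [CompactSpace X] (hY : IsLimitCone D Y π)
    (ht : ∀ {i j : J} (φ : i ⟶ j), D.map φ ≫ t j = t i)
    (hfin : ∀ j, IsFinite (t j)) (w : W ⟶ Y) [IsFinite w] [Etale w] :
    ∃ (i : J) (E : Scheme.{u}) (h : E ⟶ D.obj i) (q : W ⟶ E),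
      IsFinite h ∧ Etale h ∧ IsPullback q w h (π i) := by
  have : IsConnected J := IsCofiltered.isConnected J
  let p : Y ⟶ X := π (Classical.arbitrary J) ≫ t (Classical.arbitrary J)
  have hp (j : J) : π j ≫ t j = p := eq_of_connected ht hY.w _ _
  have key : ∃ i, DescendsOver D π t w ((w ≫ p) ⁻¹ᵁ ⊤) ⊤ i := by
    -- One affine open is added at a time; overlaps stay compact because `X` is quasi-separated.
    refine compact_open_induction_on (P := fun U : X.Opens ↦
      ∃ i, DescendsOver D π t w ((w ≫ p) ⁻¹ᵁ U) U i) ⊤ isCompact_univ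
      (DescendsOver.of_isAffineOpen hY ht hfin hp (isAffineOpen_bot X)) fun U hU V ⟨i, hi⟩ ↦ ?_
    obtain ⟨j, hj⟩ := DescendsOver.of_isAffineOpen (w := w) hY ht hfin hp V.2
    exact DescendsOver.sup hY ht hfin hp
      (hU.inter_of_isOpen V.2.isCompact U.isOpen V.1.isOpen) rfl rfl
      (hi.of_hom hY ht (IsCofiltered.minToLeft i j)) (hj.of_hom hY ht (IsCofiltered.minToRight i j))
  obtain ⟨i, E, h, q, hh, sq⟩ := key
  obtain ⟨_, _⟩ := hh.top
  let q' : ((⊤ : W.Opens) : Scheme.{u}) ⟶ E := q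
  have sq' : IsPullback q' ((⊤ : W.Opens).ι ≫ w) h (π i) := sq
  refine ⟨i, E, h, W.topIso.inv ≫ q', ‹_›, ‹_›, ?_⟩
  exact sq'.of_iso W.topIso (Iso.refl _) (Iso.refl _) (Iso.refl _)
    (by rw [W.topIso.hom_inv_id_assoc, Iso.refl_hom, Category.comp_id]) (by simp) (by simp)
    (by simp)

end CoveringSpace

/-! ### Pointed connected covers and the construction of the universal cover. -/

namespace CoveringSpace

/-- Geometric points lift along surjective finite morphisms. -/
lemma exists_lift_of_isAlgClosed {K : Type u} [Field K] [IsAlgClosed K] {E S : Scheme.{u}}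
    (h : E ⟶ S) [IsFinite h] [Surjective h] (y : Spec (.of K) ⟶ S) :
    ∃ z : Spec (.of K) ⟶ E, z ≫ h = y := by
  let f := pullback.snd h y
  have : IsFinite f := inferInstance
  have : Surjective f := inferInstance
  have : Nonempty ↥(pullback h y) := by
    obtain ⟨x, -⟩ := f.surjective (Classical.arbitrary _)
    exact ⟨x⟩
  have : CompactSpace ↥(pullback h y) := QuasiCompact.compactSpace_of_compactSpace f
  -- The fibre is finite over the algebraically closed field `K` and nonempty, so it has a closed
  -- point, which is `K`-rational.
  obtain ⟨x, -, hx⟩ := (isClosed_univ (X := ↥(pullback h y))).exists_closed_singleton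
    Set.univ_nonempty
  exact ⟨pointOfClosedPoint f x hx ≫ pullback.fst h y, by
    rw [Category.assoc, pullback.condition, pointOfClosedPoint_comp_assoc]⟩

variable {X T : Scheme.{u}} {ι : Type u} {E : ι → Scheme.{u}}

/-- The connected members of a family of schemes over `X` together with a lift of `x : T ⟶ X`. -/
structure PointedCover (h : ∀ k, E k ⟶ X) (x : T ⟶ X) : Type u where
  idx : ι
  connectedSpace : ConnectedSpace (E idx)
  pt : T ⟶ E idx
  pt_comp : pt ≫ h idx = x

namespace PointedCover

attribute [instance] connectedSpace

variable {h : ∀ k, E k ⟶ X} {x : T ⟶ X}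

/-- Morphisms over `X` preserving the base points. -/
@[ext]
structure Hom (a b : PointedCover h x) : Type u where
  hom : E a.idx ⟶ E b.idx
  w : hom ≫ h b.idx = h a.idx
  pt_hom : a.pt ≫ hom = b.pt

instance : SmallCategory (PointedCover h x) where
  Hom := Hom
  id a := ⟨𝟙 _, Category.id_comp _, Category.comp_id _⟩
  comp f g := ⟨f.hom ≫ g.hom, by rw [Category.assoc, g.w, f.w],
    by rw [← Category.assoc, f.pt_hom, g.pt_hom]⟩
  id_comp f := congr(Hom.mk $(Category.id_comp f.hom) _ _)
  comp_id f := congr(Hom.mk $(Category.comp_id f.hom) _ _)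
  assoc f g k := congr(Hom.mk $(Category.assoc f.hom g.hom k.hom) _ _)

variable (h x) in
/-- The diagram of underlying schemes. -/
abbrev diagram : PointedCover h x ⥤ Scheme.{u} where
  obj a := E a.idx
  map f := Hom.hom f
  map_id _ := rfl
  map_comp _ _ := rfl

/-- Pointed finite étale schemes over `X` receive a morphism from a member of the family. -/
lemma exists_hom [ConnectedSpace X] [ConnectedSpace T]
    (hE : ∀ (W : Scheme.{u}) (w : W ⟶ X) [IsFinite w] [Etale w],
      ∃ (k : ι) (e : W ≅ E k), e.hom ≫ h k = w)
    {W : Scheme.{u}} (w : W ⟶ X) [IsFinite w] [Etale w] (y : T ⟶ W) (hy : y ≫ w = x) :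
    ∃ (a : PointedCover h x) (f : E a.idx ⟶ W), f ≫ w = h a.idx ∧ a.pt ≫ f = y := by
  obtain ⟨U, hU, hyU, hconn⟩ := exists_connected_clopen w (y (Classical.arbitrary T))
  have := isFinite_ι_of_isClosed U hU
  have hyU' : y ⁻¹' U = Set.univ :=
    IsClopen.eq_univ ⟨hU.preimage y.continuous, U.isOpen.preimage y.continuous⟩ ⟨_, hyU⟩
  let y' : T ⟶ U := IsOpenImmersion.lift U.ι y (by
    rintro _ ⟨z, rfl⟩
    rw [Scheme.Opens.range_ι]
    exact hyU'.ge (Set.mem_univ z))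
  have hy' : y' ≫ U.ι = y := IsOpenImmersion.lift_fac _ _ _
  obtain ⟨k, e, he⟩ := hE U (U.ι ≫ w)
  have hk : ConnectedSpace (E k) :=
    e.hom.homeomorph.surjective.connectedSpace e.hom.homeomorph.continuous
  refine ⟨⟨k, hk, y' ≫ e.hom, ?_⟩, e.inv ≫ U.ι, ?_, ?_⟩
  · rw [Category.assoc, he, reassoc_of% hy', hy]
  · change (e.inv ≫ U.ι) ≫ w = h k
    rw [Category.assoc, Iso.inv_comp_eq, he]
  · change (y' ≫ e.hom) ≫ e.inv ≫ U.ι = y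
    rw [Category.assoc, e.hom_inv_id_assoc, hy']

/-- Two pointed covers are dominated by the component of their fibre product through the pair of
base points. Parallel morphisms agree at the base point of a connected scheme, so they are already
equal. -/
lemma isCofiltered [ConnectedSpace X] [ConnectedSpace T] (x : T ⟶ X)
    (h : ∀ k, E k ⟶ X) (hfin : ∀ k, IsFinite (h k)) (het : ∀ k, Etale (h k))
    (hE : ∀ (W : Scheme.{u}) (w : W ⟶ X) [IsFinite w] [Etale w],
      ∃ (k : ι) (e : W ≅ E k), e.hom ≫ h k = w) :
    IsCofiltered (PointedCover h x) where
  nonempty := by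
    obtain ⟨a, -⟩ := exists_hom hE (𝟙 X) x (Category.comp_id x)
    exact ⟨a⟩
  cone_objs a b := by
    obtain ⟨c, f, hf, hfc⟩ := exists_hom hE (pullback.fst (h a.idx) (h b.idx) ≫ h a.idx)
      (pullback.lift a.pt b.pt (by rw [a.pt_comp, b.pt_comp]))
      (by rw [pullback.lift_fst_assoc, a.pt_comp])
    refine ⟨c, ⟨f ≫ pullback.fst _ _, by rw [Category.assoc, hf], ?_⟩,
      ⟨f ≫ pullback.snd _ _, by rw [Category.assoc, ← pullback.condition, hf], ?_⟩, trivial⟩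
    · rw [reassoc_of% hfc, pullback.lift_fst]
    · rw [reassoc_of% hfc, pullback.lift_snd]
  cone_maps a b f g := by
    have hfg : f.hom = g.hom :=
      eq_of_comp_eq_comp (h b.idx) (f.w.trans g.w.symm) a.pt (f.pt_hom.trans g.pt_hom.symm)
    exact ⟨a, 𝟙 a, congr(𝟙 a ≫ $(Hom.ext hfg))⟩

end PointedCover

lemma exists_isUniversalCover (X : Scheme.{u}) [ConnectedSpace X] [CompactSpace X]
    [QuasiSeparatedSpace X] : ∃ (X' : Scheme.{u}) (p : X' ⟶ X), IsUniversalCover p := by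
  obtain ⟨ι, E, h, hfe, hE⟩ := exists_small_finite_etale X
  have hfin (k : ι) := (hfe k).1
  have het (k : ι) := (hfe k).2
  let x₀ : X := Classical.arbitrary X
  -- The base point is geometric so that it lifts along every surjective finite morphism.
  let K := AlgebraicClosure (X.residueField x₀)
  let x : Spec (.of K) ⟶ X :=
    Spec.map (CommRingCat.ofHom (algebraMap (X.residueField x₀) K)) ≫ X.fromSpecResidueField x₀
  have := PointedCover.isCofiltered x h hfin het hE
  have : IsConnected (PointedCover h x) := IsCofiltered.isConnected _
  let D := PointedCover.diagram h x
  let t (a : PointedCover h x) : D.obj a ⟶ X := h a.idx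
  have ht {a b : PointedCover h x} (f : a ⟶ b) : D.map f ≫ t b = t a := f.w
  have htf (a : PointedCover h x) : IsFinite (t a) := hfin _
  obtain ⟨X', π, hX'⟩ := exists_isLimitCone ht fun a ↦ inferInstance
  have haff {a b : PointedCover h x} (f : a ⟶ b) : IsAffineHom (D.map f) :=
    isAffineHom_map ht (fun a ↦ inferInstance) f
  have hcomp (a : PointedCover h x) : CompactSpace (D.obj a) :=
    QuasiCompact.compactSpace_of_compactSpace (t a)
  have hqs (a : PointedCover h x) : QuasiSeparatedSpace (D.obj a) :=
    quasiSeparatedSpace_of_quasiSeparated (t a)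
  have hconn (a : PointedCover h x) : ConnectedSpace (D.obj a) := a.connectedSpace
  have : ConnectedSpace X' := connectedSpace_of_isLimitCone hX'
  let a₀ : PointedCover h x := Classical.arbitrary _
  refine ⟨X', π a₀ ≫ t a₀, (isProfiniteEtale_iff _).mpr ⟨PointedCover h x, inferInstance, ‹_›, D, t,
    π, hX', ht, fun a ↦ ⟨hfin _, het _, IsLimitCone.eq_of_connected ht hX'.w _ _⟩⟩,
    isSimplyConnected_of_exists_section fun W w _ _ _ ↦ ?_⟩
  obtain ⟨i, E', h', q, _, _, sq⟩ := hX'.exists_isPullback_of_finite_etale ht htf w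
  have : Nonempty E' := ⟨q (Classical.arbitrary W)⟩
  have : Surjective h' := surjective_of_finite_etale h'
  obtain ⟨z, hz⟩ := exists_lift_of_isAlgClosed h' i.pt
  have : Etale (t i) := het _
  -- The component of `E'` through `z` is a member `a` of the system lying over `i`. Hence `π a ≫ f`
  -- lifts `π i` to `E'`, which by the cartesian square is a section of `w`.
  obtain ⟨a, f, hf, hfa⟩ := PointedCover.exists_hom (x := x) hE (h' ≫ t i) z
    (by rw [reassoc_of% hz]; exact i.pt_comp)
  let φ : a ⟶ i := ⟨f ≫ h', by rw [Category.assoc]; exact hf, by rw [reassoc_of% hfa, hz]⟩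
  have hφ : (π a ≫ f) ≫ h' = 𝟙 X' ≫ π i := by
    rw [Category.assoc, Category.id_comp]
    exact hX'.w φ
  exact ⟨sq.lift _ _ hφ, sq.lift_snd _ _ hφ⟩

end CoveringSpace

theorem mainTheorem7 (X : Scheme.{u}) [ConnectedSpace X] [CompactSpace X]
    [QuasiSeparatedSpace X] :
    (∃ (X' : Scheme.{u}) (p : X' ⟶ X), CoveringSpace.IsUniversalCover p) ∧
    ∀ (X' : Scheme.{u}) (p : X' ⟶ X), CoveringSpace.IsUniversalCover p →
      CoveringSpace.IsProfiniteEtale p ∧ Surjective p ∧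
      ∀ (Y : Scheme.{u}) (f : Y ⟶ X), CoveringSpace.IsProfiniteEtale f →
        CoveringSpace.IsYonedaTrivial (pullback.snd f p) := by
  refine ⟨CoveringSpace.exists_isUniversalCover X, fun X' p hp ↦ ?_⟩
  have := hp.isSimplyConnected.connected
  exact ⟨hp.isProfiniteEtale, hp.isProfiniteEtale.surjective, fun Y f hf ↦
    hp.isSimplyConnected.isYonedaTrivial _ _ (hf.pullback_snd p)⟩
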